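/- Let $\mathcal Y$ be a non-empty compact Hausdorff space, $\mathcal H$ a complex Hilbert space, $C$ a bounded positive semi-definite operator on $\mathcal H$, and $(A_y)_{y\in\mathcal Y}$ a family of bounded positive semi-definite operators on $\mathcal H$. Let $\mathcal H^{\otimes n}$ be the $n$-fold Hilbert space tensor power. For every $n\ge 1$ let $\mathcal X_n$ be a set of bounded positive semi-definite operators on $\mathcal H^{\otimes n}$ such that (a) $A_y^{\otimes n}X$ and $C^{\otimes n}X$ are trace-class for all $n\ge 1$, $y\in\mathcal Y$, $X\in\mathcal X_n$; (b) $X_1\otimes X_2\in\mathcal X_{n+m}$ for all $n,m\ge 1$, $X_1\in\mathcal X_n$, $X_2\in\mathcal X_m$; (c) $y\mapsto \operatorname{Tr}A_y^{\otimes n}X$ is continuous on $\mathcal Y$ for all $n\ge 1$, $X\in\mathcal X_n$. "Measure" means a positive measure on the Borel $\sigma$-algebra of $\mathcal Y$. We use the conventions $\log 0=-\infty$, $e^{-\infty}=0$, and $\log(+\infty)=+\infty$. Consider the following statements. (i) There is a probability measure $\nu$ such that for all $n\ge 1$ and $X\in\mathcal X_n$, $$\operatorname{Tr}C^{\otimes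 n}X\le\exp\Big(\int_{\mathcal Y}\log\operatorname{Tr}A_y^{\otimes n}X\,d\nu(y)\Big).$$ (ii) For every $n\ge 1$ there is a probability measure $\nu_n$ such that for all $X\in\mathcal X_n$, $$\operatorname{Tr}C^{\otimes n}X\le\exp\Big(\int_{\mathcal Y}\log\operatorname{Tr}A_y^{\otimes n}X\,d\nu_n(y)\Big).$$ (iii) There is a probability measure $\mu$ such that for all $n\ge 1$ and $X\in\mathcal X_n$, $$\operatorname{Tr}C^{\otimes n}X\le\int_{\mathcal Y}\operatorname{Tr}A_y^{\otimes n}X\,d\mu(y).$$ (iv) There are measures $(\mu_n)_{n\ge1}$ with $\limsup_{n\to\infty}\frac1n\log\mu_n(\mathcal Y)\le 0$ such that for all $n\ge 1$ and $X\in\mathcal X_n$, $$\operatorname{Tr}C^{\otimes n}X\le\int_{\mathcal Y}\operatorname{Tr}A_y^{\otimes n}X\,d\mu_n(y).$$ (v) For all $n\ge 1$ and $X\in\mathcal X_n$, $$\operatorname{Tr}C^{\otimes n}X\le\sup_{y\in\mathcal Y}\operatorname{Tr}A_y^{\otimes n}X.$$ Then (i), (ii), (iii) and (iv) are equivalent,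 and each of them implies (v). -/

import Mathlib

open scoped TensorProduct ComplexConjugate ENNReal InnerProductSpace

noncomputable section

/-! ### The Hilbert space tensor powers of a Hilbert space -/

section TensorPowers

variable (H : Type*) [NormedAddCommGroup H] [InnerProductSpace ℂ H]

/-- The algebraic `n`-fold tensor power of `H`.  (A type synonym, so that it can carry the
Hilbert space norm.) -/
def AlgPow (n : ℕ) : Type _ := ⨂[ℂ] _ : Fin n, H

instance (n : ℕ) : AddCommGroup (AlgPow H n) := inferInstanceAs (AddCommGroup (⨂[ℂ] _ : Fin n, H))

instance (n : ℕ) : Module ℂ (AlgPow H n) := inferInstanceAs (Module ℂ (⨂[ℂ] _ : Fin n, H))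

variable {H}

namespace AlgPow

/-- The elementary tensor `x₀ ⊗ ⋯ ⊗ x₍ₙ₋₁₎`. -/
def tprod {n : ℕ} (x : Fin n → H) : AlgPow H n := PiTensorProduct.tprod ℂ x

/-- Concatenation of algebraic tensors. -/
def mulEquiv (n m : ℕ) : AlgPow H n ⊗[ℂ] AlgPow H m ≃ₗ[ℂ] AlgPow H (n + m) :=
  TensorPower.mulEquiv

/-- The algebraic tensor power `C ⊗ ⋯ ⊗ C` of a linear map. -/
def map (n : ℕ) (C : H →ₗ[ℂ] H) : AlgPow H n →ₗ[ℂ] AlgPow H n :=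
  PiTensorProduct.map fun _ => C

/-- The linear functional `u ↦ ⟪x₀ ⊗ ⋯ ⊗ x₍ₙ₋₁₎, u⟫`. -/
def pairing {n : ℕ} (x : Fin n → H) : AlgPow H n →ₗ[ℂ] ℂ :=
  PiTensorProduct.lift
    ((MultilinearMap.mkPiAlgebra ℂ (Fin n) ℂ).compLinearMap fun i => innerₛₗ ℂ (x i))

theorem pairing_tprod {n : ℕ} (x y : Fin n → H) :
    pairing x (tprod y) = ∏ i, ⟪x i, y i⟫_ℂ := by
  simp only [pairing, tprod]
  erw [PiTensorProduct.lift.tprod]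
  simp

theorem induction {n : ℕ} {p : AlgPow H n → Prop}
    (h1 : ∀ (c : ℂ) (x : Fin n → H), p (c • tprod x)) (h2 : ∀ u v, p u → p v → p (u + v))
    (u : AlgPow H n) : p u :=
  PiTensorProduct.induction_on (motive := p) u h1 h2

theorem linearMap_ext {n : ℕ} {F : Type*} [AddCommGroup F] [Module ℂ F] {σ : ℂ →+* ℂ}
    {f g : AlgPow H n →ₛₗ[σ] F}
    (h : ∀ x, f (tprod x) = g (tprod x)) : f = g := by
  ext u
  induction u using induction with
  | h1 c x => simp [h x]
  | h2 u v hu hv => simp [hu, hv]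


theorem star_pairing_tprod {n : ℕ} (x y : Fin n → H) :
    star (pairing x (tprod y)) =
      (MultilinearMap.mkPiAlgebra ℂ (Fin n) ℂ).compLinearMap (fun i => innerₛₗ ℂ (y i)) x := by
  simp [pairing_tprod, star_prod]

/-- The form `u ↦ (v ↦ ⟪v, u⟫)`, determined by
`⟪y₀ ⊗ ⋯ ⊗ y₍ₙ₋₁₎, x₀ ⊗ ⋯ ⊗ x₍ₙ₋₁₎⟫ = ∏ i, ⟪yᵢ, xᵢ⟫`. -/
def form (n : ℕ) : AlgPow H n →ₗ[ℂ] AlgPow H n →ₗ⋆[ℂ] ℂ :=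
  PiTensorProduct.lift
    { toFun := fun x => (starLinearEquiv ℂ (A := ℂ)).toLinearMap.comp (pairing x)
      map_update_add' := by
        intro _ x i a b
        refine linearMap_ext fun y => ?_
        simp only [LinearMap.comp_apply, LinearMap.add_apply, LinearEquiv.coe_coe,
          starLinearEquiv_apply, star_pairing_tprod]
        convert! MultilinearMap.map_update_add _ x i a b
      map_update_smul' := by
        intro _ x i c a
        refine linearMap_ext fun y => ?_
        simp only [LinearMap.comp_apply, LinearMap.smul_apply, LinearEquiv.coe_coe,
          starLinearEquiv_apply, star_pairing_tprod]
        convert! MultilinearMap.map_update_smul _ x i c a }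

theorem form_tprod {n : ℕ} (x y : Fin n → H) :
    form n (tprod x) (tprod y) = ∏ i, ⟪y i, x i⟫_ℂ := by
  have : form n (tprod x) = (starLinearEquiv ℂ (A := ℂ)).toLinearMap.comp (pairing x) :=
    PiTensorProduct.lift.tprod _
  rw [this]
  simp only [LinearMap.comp_apply, LinearEquiv.coe_coe, starLinearEquiv_apply, star_pairing_tprod]
  simp

theorem mulEquiv_tprod {n m : ℕ} (x : Fin n → H) (y : Fin m → H) :
    mulEquiv n m (tprod x ⊗ₜ[ℂ] tprod y) = tprod (Fin.append x y) :=
  TensorPower.tprod_mul_tprod ℂ x y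

theorem map_tprod {n : ℕ} (C : H →ₗ[ℂ] H) (x : Fin n → H) :
    map n C (tprod x) = tprod (fun i => C (x i)) :=
  PiTensorProduct.map_tprod _ _

theorem form_conj_symm {n : ℕ} (u v : AlgPow H n) : conj (form n u v) = form n v u := by
  induction u using induction with
  | h1 c x =>
    induction v using induction with
    | h1 d y => simp [form_tprod, map_prod]; ring
    | h2 v w hv hw => simp only [map_add, LinearMap.add_apply, hv, hw]
  | h2 u w hu hw => simp only [map_add, LinearMap.add_apply, hu, hw]

/-- Inner product spaces structures on two tensor powers that are given by `form` induce the
form on the larger tensor power. -/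
theorem inner_eq_form_mulEquiv {n m : ℕ}
    (cn : InnerProductSpace.Core ℂ (AlgPow H n)) (cm : InnerProductSpace.Core ℂ (AlgPow H m))
    (hn : ∀ u v, cn.inner u v = form n v u) (hm : ∀ u v, cm.inner u v = form m v u)
    (s t : AlgPow H n ⊗[ℂ] AlgPow H m) :
    letI := cn.toNormedAddCommGroup
    letI : InnerProductSpace ℂ (AlgPow H n) := .ofCore cn.toCore
    letI := cm.toNormedAddCommGroup
    letI : InnerProductSpace ℂ (AlgPow H m) := .ofCore cm.toCore
    ⟪s, t⟫_ℂ = form (n + m) (mulEquiv n m t) (mulEquiv n m s) := by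
  let := cn.toNormedAddCommGroup
  let : InnerProductSpace ℂ (AlgPow H n) := .ofCore cn.toCore
  let := cm.toNormedAddCommGroup
  let : InnerProductSpace ℂ (AlgPow H m) := .ofCore cm.toCore
  have hn' : ∀ u v : AlgPow H n, ⟪u, v⟫_ℂ = form n v u := hn
  have hm' : ∀ u v : AlgPow H m, ⟪u, v⟫_ℂ = form m v u := hm
  have key : ∀ (a a' : AlgPow H n) (b b' : AlgPow H m), form n a' a * form m b' b =
      form (n + m) (mulEquiv n m (a' ⊗ₜ[ℂ] b')) (mulEquiv n m (a ⊗ₜ[ℂ] b)) := by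
    intro a a' b b'
    induction a using induction with
    | h2 u v hu hv => simp only [map_add, add_mul, hu, hv, TensorProduct.add_tmul]
    | h1 c x =>
      induction a' using induction with
      | h2 u v hu hv =>
        simp only [map_add, LinearMap.add_apply, add_mul, hu, hv, TensorProduct.add_tmul]
      | h1 d y =>
        induction b using induction with
        | h2 u v hu hv => simp only [map_add, mul_add, hu, hv, TensorProduct.tmul_add]
        | h1 e z =>
          induction b' using induction with
          | h2 u v hu hv =>
            simp only [map_add, LinearMap.add_apply, mul_add, hu, hv, TensorProduct.tmul_add]
          | h1 f w =>
            simp only [← TensorProduct.smul_tmul', TensorProduct.tmul_smul, map_smul,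
              LinearMap.smul_apply, map_smulₛₗ, mulEquiv_tprod, form_tprod, Fin.prod_univ_add,
              Fin.append_left, Fin.append_right, smul_eq_mul]
            ring
  induction s using TensorProduct.induction_on with
  | zero => simp
  | add s s' hs hs' => simp only [inner_add_left, map_add, hs, hs']
  | tmul a b =>
    induction t using TensorProduct.induction_on with
    | zero => simp
    | add t t' ht ht' => simp only [inner_add_right, map_add, LinearMap.add_apply, ht, ht']
    | tmul a' b' => rw [TensorProduct.inner_tmul, hn', hm', key]

theorem exists_eq_smul (u : AlgPow H 0) : ∃ c : ℂ, u = c • tprod Fin.elim0 := by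
  induction u using induction with
  | h1 c x => exact ⟨c, by rw [Subsingleton.elim x]⟩
  | h2 u v hu hv =>
    obtain ⟨c, rfl⟩ := hu
    obtain ⟨d, rfl⟩ := hv
    exact ⟨c + d, by rw [add_smul]⟩

theorem exists_eq_tprod (u : AlgPow H 1) : ∃ x : H, u = tprod fun _ => x := by
  refine ⟨PiTensorProduct.subsingletonEquiv (0 : Fin 1) u, ?_⟩
  refine ((PiTensorProduct.subsingletonEquiv (R := ℂ) (s := fun _ => H)
    (0 : Fin 1)).symm_apply_apply u).symm.trans ?_
  rw [PiTensorProduct.subsingletonEquiv_symm_apply, tprod]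
  congr 1
  funext i
  obtain rfl : i = 0 := Subsingleton.elim i 0
  simp

/-- The inner product space structure, from positivity and definiteness of the form. -/
abbrev coreOf {n : ℕ} (h0 : ∀ u : AlgPow H n, 0 ≤ (form n u u).re)
    (h1 : ∀ u : AlgPow H n, form n u u = 0 → u = 0) : InnerProductSpace.Core ℂ (AlgPow H n) where
  inner u v := form n v u
  conj_inner_symm u v := form_conj_symm u v
  re_inner_nonneg u := h0 u
  add_left u v w := by simp
  smul_left u v c := by simp
  definite u := h1 u

theorem form_pos_definite (n : ℕ) :
    (∀ u : AlgPow H n, 0 ≤ (form n u u).re) ∧ ∀ u : AlgPow H n, form n u u = 0 → u = 0 := by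
  induction n with
  | zero =>
    refine ⟨fun u => ?_, fun u hu => ?_⟩ <;> obtain ⟨c, rfl⟩ := exists_eq_smul u
    · have : 0 ≤ c.re * c.re + c.im * c.im := add_nonneg (mul_self_nonneg _) (mul_self_nonneg _)
      simpa [form_tprod] using this
    · simp [form_tprod] at hu
      simp [hu]
  | succ n ih =>
    have one : (∀ u : AlgPow H 1, 0 ≤ (form 1 u u).re) ∧
        ∀ u : AlgPow H 1, form 1 u u = 0 → u = 0 := by
      refine ⟨fun u => ?_, fun u hu => ?_⟩ <;> obtain ⟨x, rfl⟩ := exists_eq_tprod u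
      · simpa [form_tprod] using inner_self_nonneg (𝕜 := ℂ) (x := x)
      · have : x = 0 := by simpa [form_tprod] using hu
        subst this
        exact (PiTensorProduct.tprod ℂ).map_zero
    let cn := coreOf ih.1 ih.2
    let c1 := coreOf one.1 one.2
    have h := inner_eq_form_mulEquiv cn c1 (fun _ _ => rfl) (fun _ _ => rfl)
    let := cn.toNormedAddCommGroup
    let : InnerProductSpace ℂ (AlgPow H n) := .ofCore cn.toCore
    let := c1.toNormedAddCommGroup
    let : InnerProductSpace ℂ (AlgPow H 1) := .ofCore c1.toCore
    refine ⟨fun u => ?_, fun u hu => ?_⟩ <;>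
      obtain ⟨s, rfl⟩ := (mulEquiv n 1).surjective u
    · rw [← h s s]
      exact inner_self_nonneg (𝕜 := ℂ) (x := s)
    · rw [← h s s] at hu
      rw [(inner_self_eq_zero (𝕜 := ℂ) (x := s)).1 hu, map_zero]

/-- The inner product of the algebraic tensor power, with
`⟪x₀ ⊗ ⋯ ⊗ x₍ₙ₋₁₎, y₀ ⊗ ⋯ ⊗ y₍ₙ₋₁₎⟫ = ∏ i, ⟪xᵢ, yᵢ⟫`. -/
instance instCore (n : ℕ) : InnerProductSpace.Core ℂ (AlgPow H n) :=
  coreOf (form_pos_definite n).1 (form_pos_definite n).2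

instance (n : ℕ) : NormedAddCommGroup (AlgPow H n) := (instCore n).toNormedAddCommGroup

instance (n : ℕ) : InnerProductSpace ℂ (AlgPow H n) := .ofCore (instCore n).toCore

theorem inner_tprod {n : ℕ} (x y : Fin n → H) :
    ⟪tprod x, tprod y⟫_ℂ = ∏ i, ⟪x i, y i⟫_ℂ :=
  form_tprod y x

/-- Concatenation of tensors is isometric. -/
def mulIsometry (n m : ℕ) : AlgPow H n ⊗[ℂ] AlgPow H m ≃ₗᵢ[ℂ] AlgPow H (n + m) :=
  (mulEquiv n m).isometryOfInner fun s t =>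
    (inner_eq_form_mulEquiv (instCore n) (instCore m) (fun _ _ => rfl) (fun _ _ => rfl) s t).symm

theorem mulIsometry_tprod {n m : ℕ} (x : Fin n → H) (y : Fin m → H) :
    mulIsometry n m (tprod x ⊗ₜ[ℂ] tprod y) = tprod (Fin.append x y) :=
  mulEquiv_tprod x y


theorem map_bounded (C : H →L[ℂ] H) (n : ℕ) :
    ∃ c : ℝ, ∀ u : AlgPow H n, ‖map n (C : H →ₗ[ℂ] H) u‖ ≤ c * ‖u‖ := by
  induction n with
  | zero =>
    refine ⟨1, fun u => ?_⟩
    obtain ⟨c, rfl⟩ := exists_eq_smul u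
    rw [map_smul, map_tprod, one_mul]
    apply le_of_eq
    congr 3
    exact Subsingleton.elim _ _
  | succ n ih =>
    have one : ∃ c : ℝ, ∀ u : AlgPow H 1, ‖map 1 (C : H →ₗ[ℂ] H) u‖ ≤ c * ‖u‖ := by
      have hnorm : ∀ x : H, ‖(tprod fun _ => x : AlgPow H 1)‖ = ‖x‖ := fun x => by
        rw [norm_eq_sqrt_re_inner (𝕜 := ℂ), norm_eq_sqrt_re_inner (𝕜 := ℂ) x, inner_tprod]
        simp
      refine ⟨‖C‖, fun u => ?_⟩
      obtain ⟨x, rfl⟩ := exists_eq_tprod u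
      rw [map_tprod, hnorm, ContinuousLinearMap.coe_coe, hnorm]
      exact C.le_opNorm x
    let f := (map n (C : H →ₗ[ℂ] H)).mkContinuousOfExistsBound ih
    let g := (map 1 (C : H →ₗ[ℂ] H)).mkContinuousOfExistsBound one
    have key : ∀ s, map (n + 1) (C : H →ₗ[ℂ] H) (mulIsometry n 1 s) =
        mulIsometry n 1 (TensorProduct.mapL f g s) := by
      intro s
      induction s using TensorProduct.induction_on with
      | zero => simp
      | add s t hs ht => simp only [map_add, hs, ht]
      | tmul a b =>
        rw [TensorProduct.mapL_tmul]
        change _ = mulIsometry n 1 (map n (C : H →ₗ[ℂ] H) a ⊗ₜ[ℂ] map 1 (C : H →ₗ[ℂ] H) b)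
        obtain ⟨y, rfl⟩ := exists_eq_tprod b
        induction a using induction with
        | h2 u v hu hv => simp only [map_add, hu, hv, TensorProduct.add_tmul]
        | h1 c x =>
          simp only [← TensorProduct.smul_tmul', map_smul, mulIsometry_tprod, map_tprod]
          congr 2
          funext i
          refine Fin.addCases (fun i => ?_) (fun i => ?_) i
          · simp only [Fin.append_left]
          · simp only [Fin.append_right]
    refine ⟨‖TensorProduct.mapL f g‖, fun u => ?_⟩
    obtain ⟨s, rfl⟩ := (mulIsometry n 1).surjective u
    rw [key, LinearIsometryEquiv.norm_map, LinearIsometryEquiv.norm_map]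
    exact ContinuousLinearMap.le_opNorm _ _

/-- The algebraic tensor power of a bounded operator, as a bounded operator. -/
def mapL (n : ℕ) (C : H →L[ℂ] H) : AlgPow H n →L[ℂ] AlgPow H n :=
  (map n (C : H →ₗ[ℂ] H)).mkContinuousOfExistsBound (map_bounded C n)

end AlgPow

variable (H) in
/-- The `n`-th tensor power `H^{⊗n}` of a Hilbert space: the completion of the algebraic one. -/
abbrev HilbertPow (n : ℕ) : Type _ := UniformSpace.Completion (AlgPow H n)

namespace HilbertPow

open UniformSpace.Completion

/-- The elementary tensor `x₀ ⊗ ⋯ ⊗ x₍ₙ₋₁₎` in `H^{⊗n}`. -/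
def tprod {n : ℕ} (x : Fin n → H) : HilbertPow H n := (AlgPow.tprod x : AlgPow H n)

theorem inner_tprod {n : ℕ} (x y : Fin n → H) :
    ⟪tprod x, tprod y⟫_ℂ = ∏ i, ⟪x i, y i⟫_ℂ := by
  rw [tprod, tprod, inner_coe, AlgPow.inner_tprod]

/-- The tensor power `C^{⊗n}` of a bounded operator: the continuous extension to `H^{⊗n}` of the
algebraic tensor power. -/
def opPow (C : H →L[ℂ] H) (n : ℕ) : HilbertPow H n →L[ℂ] HilbertPow H n :=
  (toComplL ∘L AlgPow.mapL n C).extend toComplL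

theorem isUniformInducing_toComplL (n : ℕ) :
    IsUniformInducing (toComplL (𝕜 := ℂ) (E := AlgPow H n)) :=
  UniformSpace.Completion.isUniformInducing_coe _

theorem denseRange_toComplL (n : ℕ) : DenseRange (toComplL (𝕜 := ℂ) (E := AlgPow H n)) :=
  UniformSpace.Completion.denseRange_coe

theorem opPow_tprod (C : H →L[ℂ] H) {n : ℕ} (x : Fin n → H) :
    opPow C n (tprod x) = tprod fun i => C (x i) := by
  refine (ContinuousLinearMap.extend_eq _ (denseRange_toComplL n)
    (isUniformInducing_toComplL n) (AlgPow.tprod x)).trans ?_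
  exact congrArg (fun u : AlgPow H n => (u : HilbertPow H n))
    (AlgPow.map_tprod (C : H →ₗ[ℂ] H) x)

/-- The inclusion of the algebraic tensor product of the algebraic powers into the algebraic
tensor product of the completed powers. -/
def incl (n m : ℕ) :
    AlgPow H n ⊗[ℂ] AlgPow H m →ₗᵢ[ℂ] HilbertPow H n ⊗[ℂ] HilbertPow H m :=
  TensorProduct.mapIsometry (toComplₗᵢ (𝕜 := ℂ) (E := AlgPow H n))
    (toComplₗᵢ (𝕜 := ℂ) (E := AlgPow H m))

theorem denseRange_incl (n m : ℕ) : DenseRange (incl (H := H) n m).toContinuousLinearMap := by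
  have hcl : ∀ w : HilbertPow H n ⊗[ℂ] HilbertPow H m,
      w ∈ (LinearMap.range (incl (H := H) n m).toLinearMap).topologicalClosure := by
    intro w
    induction w using TensorProduct.induction_on with
    | zero => exact zero_mem _
    | add s t hs ht => exact add_mem hs ht
    | tmul a b =>
      have h : ∀ (a : HilbertPow H n) (b : HilbertPow H m), a ⊗ₜ[ℂ] b ∈
          (LinearMap.range (incl (H := H) n m).toLinearMap).topologicalClosure := by
        intro a b
        induction a, b using UniformSpace.Completion.induction_on₂ with
        | hp =>
          exact (Submodule.isClosed_topologicalClosure _).preimage TensorProduct.continuous_tmul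
        | ih a b => exact subset_closure ⟨a ⊗ₜ[ℂ] b, rfl⟩
      exact h a b
  exact fun w => hcl w

theorem isUniformInducing_incl (n m : ℕ) :
    IsUniformInducing (incl (H := H) n m).toContinuousLinearMap :=
  (incl (H := H) n m).isometry.isUniformInducing

/-- The concatenation map `u ⊗ v ↦ u ⊗ v` from `H^{⊗n} ⊗ H^{⊗m}` to `H^{⊗(n+m)}`, the continuous
extension of the algebraic one. -/
def concat (n m : ℕ) : HilbertPow H n ⊗[ℂ] HilbertPow H m →L[ℂ] HilbertPow H (n + m) :=
  (toComplL ∘L ((AlgPow.mulIsometry n m).toLinearIsometry.toContinuousLinearMap :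
      AlgPow H n ⊗[ℂ] AlgPow H m →L[ℂ] AlgPow H (n + m))).extend
    (incl n m).toContinuousLinearMap

theorem concat_incl (n m : ℕ) (s : AlgPow H n ⊗[ℂ] AlgPow H m) :
    concat n m (incl n m s) = (AlgPow.mulIsometry n m s : HilbertPow H (n + m)) :=
  ContinuousLinearMap.extend_eq _ (denseRange_incl n m) (isUniformInducing_incl n m) s

theorem concat_tprod {n m : ℕ} (x : Fin n → H) (y : Fin m → H) :
    concat n m (tprod x ⊗ₜ[ℂ] tprod y) = tprod (Fin.append x y) := by
  refine (concat_incl n m (AlgPow.tprod x ⊗ₜ[ℂ] AlgPow.tprod y)).trans ?_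
  rw [AlgPow.mulIsometry_tprod, tprod]

/-- The tensor product `X₁ ⊗ X₂` of bounded operators on `H^{⊗n}` and `H^{⊗m}`, as a bounded
operator on `H^{⊗(n+m)}`. -/
def opTensor {n m : ℕ} (X₁ : HilbertPow H n →L[ℂ] HilbertPow H n)
    (X₂ : HilbertPow H m →L[ℂ] HilbertPow H m) :
    HilbertPow H (n + m) →L[ℂ] HilbertPow H (n + m) :=
  (concat n m ∘L TensorProduct.mapL X₁ X₂ ∘L (incl n m).toContinuousLinearMap ∘L
    ((AlgPow.mulIsometry n m).symm.toLinearIsometry.toContinuousLinearMap :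
      AlgPow H (n + m) →L[ℂ] AlgPow H n ⊗[ℂ] AlgPow H m)).extend toComplL

/-- The defining property `(X₁ ⊗ X₂) (u ⊗ v) = X₁ u ⊗ X₂ v`. -/
theorem opTensor_concat {n m : ℕ} (X₁ : HilbertPow H n →L[ℂ] HilbertPow H n)
    (X₂ : HilbertPow H m →L[ℂ] HilbertPow H m) (u : HilbertPow H n) (v : HilbertPow H m) :
    opTensor X₁ X₂ (concat n m (u ⊗ₜ[ℂ] v)) = concat n m (X₁ u ⊗ₜ[ℂ] X₂ v) := by
  have h : ∀ w, opTensor X₁ X₂ (concat n m w) = concat n m (TensorProduct.mapL X₁ X₂ w) := by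
    refine fun w => (denseRange_incl n m).induction_on w
      (isClosed_eq (by fun_prop) (by fun_prop)) fun s => ?_
    refine (congrArg _ (concat_incl n m s)).trans ?_
    refine (ContinuousLinearMap.extend_eq _ (denseRange_toComplL _)
      (isUniformInducing_toComplL _) (AlgPow.mulIsometry n m s)).trans ?_
    simp
  exact h _

end HilbertPow

end TensorPowers

/-! ### Trace-class operators and the trace -/

section Trace

variable {E : Type*} [NormedAddCommGroup E] [InnerProductSpace ℂ E] [CompleteSpace E]

variable (E) in
/-- A (fixed, arbitrary) orthonormal basis of a Hilbert space. -/
def someHilbertBasis : HilbertBasis (exists_hilbertBasis ℂ E).choose ℂ E :=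
  (exists_hilbertBasis ℂ E).choose_spec.choose

/-- `T` is trace-class: `Tr |T| = ∑ i, ⟪eᵢ, |T| eᵢ⟫ < ∞`, where `|T| = (T⋆ T)^{1/2}`.  (All terms
are nonnegative, so that summability means that the sum is finite; the choice of the orthonormal
basis does not matter.) -/
def IsTraceClass (T : E →L[ℂ] E) : Prop :=
  Summable fun i => (⟪someHilbertBasis E i, CFC.abs T (someHilbertBasis E i)⟫_ℂ).re

/-- The trace `Tr T = ∑ i, ⟪eᵢ, T eᵢ⟫` of a trace-class operator. -/
def opTrace (T : E →L[ℂ] E) : ℂ :=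
  ∑' i, ⟪someHilbertBasis E i, T (someHilbertBasis E i)⟫_ℂ

/-- The trace `Tr A X`, as an element of `[0, ∞]`, for positive semi-definite `A`, `X` with `A X`
trace-class.  (Then `Tr A X` is a nonnegative real number.) -/
def trMul (A X : E →L[ℂ] E) : ℝ≥0∞ := ENNReal.ofReal (opTrace (A * X)).re

end Trace

/-! ### Integrals of extended real valued functions -/

/-- The integral `∫ f⁺ dμ - ∫ f⁻ dμ` of a function with values in `[-∞, ∞]`. -/
def erealIntegral {Y : Type*} [MeasurableSpace Y] (μ : MeasureTheory.Measure Y) (f : Y → EReal) :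
    EReal :=
  ((∫⁻ y, (f y).toENNReal ∂μ : ℝ≥0∞) : EReal) - ((∫⁻ y, (-f y).toENNReal ∂μ : ℝ≥0∞) : EReal)

/-! ### The bounds -/

section Bounds

open HilbertPow MeasureTheory

variable {H : Type*} [NormedAddCommGroup H] [InnerProductSpace ℂ H]
  {Y : Type*} (A : Y → H →L[ℂ] H) (C : H →L[ℂ] H)
  (X : (n : ℕ) → Set (HilbertPow H n →L[ℂ] HilbertPow H n)) (n : ℕ)

/-- `Tr C^{⊗n} x ≤ exp (∫ log Tr A_y^{⊗n} x dν(y))` for all `x ∈ X n`, with `log 0 = -∞`,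
`exp (-∞) = 0`. -/
def GeometricBound [MeasurableSpace Y] (ν : Measure Y) : Prop :=
  ∀ x ∈ X n, trMul (opPow C n) x ≤
    EReal.exp (erealIntegral ν fun y => ENNReal.log (trMul (opPow (A y) n) x))

/-- `Tr C^{⊗n} x ≤ ∫ Tr A_y^{⊗n} x dμ(y)` for all `x ∈ X n`. -/
def ArithmeticBound [MeasurableSpace Y] (μ : Measure Y) : Prop :=
  ∀ x ∈ X n, trMul (opPow C n) x ≤ ∫⁻ y, trMul (opPow (A y) n) x ∂μ

/-- `Tr C^{⊗n} x ≤ sup_y Tr A_y^{⊗n} x` for all `x ∈ X n`. -/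
def SupBound : Prop :=
  ∀ x ∈ X n, trMul (opPow C n) x ≤ ⨆ y, trMul (opPow (A y) n) x

end Bounds

end

open HilbertPow MeasureTheory Filter

/-!
The trace is multiplicative on tensor products, and `Tr A X ≥ 0` for positive `A`, `X`; so the pairs
`(y ↦ Tr A_y^{⊗n} x, Tr C^{⊗n} x)` form a family of nonnegative functions and numbers which is
closed under products. If arithmetic bounds hold with masses of subexponential growth, applying them
to `x^{⊗k}` and taking `k`-th roots as `k → ∞` gives the bound by the supremum. Conversely, suppose
every pair `(f, c)` of the family satisfies `c ≤ sup f`. Closure under products makes the logarithms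
`log (f / c)`, up to positive rational multiples, a convex set. None of its elements is negative
everywhere, so Hahn–Banach and Riesz–Markov–Kakutani provide one probability measure `ν` with
`∫ log (f / c) dν ≥ 0` for the whole family, which is the geometric bound. Jensen's inequality turns
geometric bounds into arithmetic ones.
-/

/-! ### Hilbert–Schmidt operators -/

section Parseval

variable {𝕜 E F ι κ : Type*} [RCLike 𝕜] [NormedAddCommGroup E] [InnerProductSpace 𝕜 E]
  [NormedAddCommGroup F] [InnerProductSpace 𝕜 F]

theorem hasSum_sq_norm_inner (b : HilbertBasis ι 𝕜 E) (x : E) :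
    HasSum (fun i => ‖⟪b i, x⟫_𝕜‖ ^ 2) (‖x‖ ^ 2) := by
  simpa [b.repr_apply_apply] using lp.hasSum_norm (p := 2) (by norm_num) (b.repr x)

theorem summable_prod_sq_norm_inner (f : HilbertBasis κ 𝕜 F) {u : ι → F}
    (hu : Summable fun i => ‖u i‖ ^ 2) :
    Summable fun p : ι × κ => ‖⟪f p.2, u p.1⟫_𝕜‖ ^ 2 :=
  (summable_prod_of_nonneg fun _ => sq_nonneg _).2
    ⟨fun i => (hasSum_sq_norm_inner f (u i)).summable,
      hu.congr fun i => (hasSum_sq_norm_inner f (u i)).tsum_eq.symm⟩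

theorem summable_sq_norm_adjoint_apply [CompleteSpace E] [CompleteSpace F]
    (b : HilbertBasis ι 𝕜 E) (f : HilbertBasis κ 𝕜 F) {T : E →L[𝕜] F}
    (hT : Summable fun i => ‖T (b i)‖ ^ 2) : Summable fun j => ‖T.adjoint (f j)‖ ^ 2 := by
  refine (summable_prod_sq_norm_inner f hT).prod_symm.prod.congr fun j => ?_
  rw [← (hasSum_sq_norm_inner b (T.adjoint (f j))).tsum_eq]
  refine tsum_congr fun i => ?_
  rw [ContinuousLinearMap.adjoint_inner_right, norm_inner_symm]
  rfl

end Parseval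

section HilbertSchmidt

variable {E : Type*} [NormedAddCommGroup E] [InnerProductSpace ℂ E] [CompleteSpace E]

/-- The Hilbert–Schmidt operators: `∑ i, ‖T eᵢ‖² < ∞`, for the basis that also enters
`IsTraceClass`; by `IsHilbertSchmidt.summable` any other basis gives the same operators. -/
def IsHilbertSchmidt (T : E →L[ℂ] E) : Prop :=
  Summable fun i => ‖T (someHilbertBasis E i)‖ ^ 2

namespace IsHilbertSchmidt

variable {T S : E →L[ℂ] E} {ι κ : Type*}

theorem adjoint (hT : IsHilbertSchmidt T) : IsHilbertSchmidt T.adjoint :=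
  summable_sq_norm_adjoint_apply _ _ hT

theorem summable (hT : IsHilbertSchmidt T) (b : HilbertBasis ι ℂ E) :
    Summable fun i => ‖T (b i)‖ ^ 2 := by
  simpa only [ContinuousLinearMap.adjoint_adjoint] using
    summable_sq_norm_adjoint_apply _ b hT.adjoint

theorem mul_left (hT : IsHilbertSchmidt T) (B : E →L[ℂ] E) : IsHilbertSchmidt (B * T) := by
  refine .of_nonneg_of_le (fun _ => sq_nonneg _) (fun i => ?_) (Summable.mul_left (‖B‖ ^ 2) hT)
  rw [← mul_pow]
  gcongr
  exact B.le_opNorm _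

theorem mul_right (hT : IsHilbertSchmidt T) (B : E →L[ℂ] E) : IsHilbertSchmidt (T * B) := by
  have h := (hT.adjoint.mul_left B.adjoint).adjoint
  simpa only [← ContinuousLinearMap.star_eq_adjoint, star_mul, star_star] using h

theorem hasSum_inner_mul (f : HilbertBasis κ ℂ E) (x y : E) :
    HasSum (fun j => ⟪x, T (f j)⟫_ℂ * ⟪f j, S y⟫_ℂ) ⟪x, (T * S) y⟫_ℂ := by
  have h := f.hasSum_inner_mul_inner (T.adjoint x) (S y)
  simp only [ContinuousLinearMap.adjoint_inner_left] at h
  exact h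

theorem summable_prod (hT : IsHilbertSchmidt T) (hS : IsHilbertSchmidt S)
    (b : HilbertBasis ι ℂ E) (f : HilbertBasis κ ℂ E) :
    Summable fun p : ι × κ => ⟪b p.1, T (f p.2)⟫_ℂ * ⟪f p.2, S (b p.1)⟫_ℂ := by
  have hT' := (summable_prod_sq_norm_inner b (hT.summable f)).prod_symm
  have hS' := summable_prod_sq_norm_inner f (hS.summable b)
  refine Summable.of_norm_bounded (hT'.add hS') fun p => ?_
  rw [norm_mul]
  have h := two_mul_le_add_sq ‖⟪b p.1, T (f p.2)⟫_ℂ‖ ‖⟪f p.2, S (b p.1)⟫_ℂ‖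
  have h₀ : 0 ≤ ‖⟪b p.1, T (f p.2)⟫_ℂ‖ * ‖⟪f p.2, S (b p.1)⟫_ℂ‖ := by positivity
  simp only [Prod.fst_swap, Prod.snd_swap]
  linarith

theorem summable_inner_mul (hT : IsHilbertSchmidt T) (hS : IsHilbertSchmidt S)
    (b : HilbertBasis ι ℂ E) : Summable fun i => ⟪b i, (T * S) (b i)⟫_ℂ :=
  (hT.summable_prod hS b b).prod.congr fun i => (hasSum_inner_mul b (b i) (b i)).tsum_eq

theorem tsum_inner_mul_comm (hT : IsHilbertSchmidt T) (hS : IsHilbertSchmidt S)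
    (b : HilbertBasis ι ℂ E) (f : HilbertBasis κ ℂ E) :
    ∑' i, ⟪b i, (T * S) (b i)⟫_ℂ = ∑' j, ⟪f j, (S * T) (f j)⟫_ℂ :=
  calc ∑' i, ⟪b i, (T * S) (b i)⟫_ℂ
      = ∑' i, ∑' j, ⟪b i, T (f j)⟫_ℂ * ⟪f j, S (b i)⟫_ℂ :=
        tsum_congr fun i => (hasSum_inner_mul f (b i) (b i)).tsum_eq.symm
    _ = ∑' j, ∑' i, ⟪b i, T (f j)⟫_ℂ * ⟪f j, S (b i)⟫_ℂ :=
        (Summable.tsum_comm (f := fun i j => ⟪b i, T (f j)⟫_ℂ * ⟪f j, S (b i)⟫_ℂ)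
          (hT.summable_prod hS b f)).symm
    _ = ∑' j, ∑' i, ⟪f j, S (b i)⟫_ℂ * ⟪b i, T (f j)⟫_ℂ := by simp only [mul_comm]
    _ = ∑' j, ⟪f j, (S * T) (f j)⟫_ℂ :=
        tsum_congr fun j => (hasSum_inner_mul b (f j) (f j)).tsum_eq

theorem opTrace_mul_comm (hT : IsHilbertSchmidt T) (hS : IsHilbertSchmidt S) :
    opTrace (T * S) = opTrace (S * T) :=
  hT.tsum_inner_mul_comm hS _ _

theorem tendsto_opTrace_mul_mul (hT : IsHilbertSchmidt T) (hS : IsHilbertSchmidt S) {α : Type*}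
    {l : Filter α} {K : α → E →L[ℂ] E} {c : ℝ} (hK : ∀ j, ‖K j‖ ≤ c)
    (hSK : Tendsto (fun j => S * K j) l (nhds 0)) :
    Tendsto (fun j => opTrace (T * S * K j)) l (nhds 0) := by
  have hcyc (j : α) : opTrace (T * S * K j) = opTrace (S * K j * T) := by
    rw [mul_assoc, hT.opTrace_mul_comm (hS.mul_right _)]
  simp only [hcyc]
  simp only [opTrace]
  rw [← tsum_zero (β := (exists_hilbertBasis ℂ E).choose)]
  refine tendsto_tsum_of_dominated_convergence
    (bound := fun i => c * (‖S.adjoint (someHilbertBasis E i)‖ ^ 2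
      + ‖T (someHilbertBasis E i)‖ ^ 2))
    ((hS.adjoint.add hT).mul_left c) (fun i => ?_) (.of_forall fun j i => ?_) <;>
    set e := someHilbertBasis E i
  · have h := ((ContinuousLinearMap.apply ℂ E (T e)).continuous.tendsto _).comp hSK
    simpa using (tendsto_const_nhds (x := e)).inner (𝕜 := ℂ) h
  · have hc : 0 ≤ c := (norm_nonneg _).trans (hK j)
    have h := two_mul_le_add_sq ‖S.adjoint e‖ ‖T e‖
    have h₀ : 0 ≤ ‖S.adjoint e‖ * ‖T e‖ := by positivity
    calc ‖⟪e, (S * K j * T) e⟫_ℂ‖ = ‖⟪S.adjoint e, K j (T e)⟫_ℂ‖ := by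
          rw [ContinuousLinearMap.adjoint_inner_left]; rfl
      _ ≤ ‖S.adjoint e‖ * (c * ‖T e‖) :=
          (norm_inner_le_norm _ _).trans (by gcongr; exact (K j).le_of_opNorm_le (hK j) _)
      _ = c * (‖S.adjoint e‖ * ‖T e‖) := by ring
      _ ≤ c * (‖S.adjoint e‖ ^ 2 + ‖T e‖ ^ 2) := by gcongr; linarith

end IsHilbertSchmidt

end HilbertSchmidt

/-! ### Trace-class operators -/

section Factorization

variable {𝕜 E F G : Type*} [RCLike 𝕜] [NormedAddCommGroup E] [NormedSpace 𝕜 E]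
  [NormedAddCommGroup F] [InnerProductSpace 𝕜 F] [CompleteSpace F]
  [NormedAddCommGroup G] [NormedSpace 𝕜 G] [CompleteSpace G]

/-- Douglas' factorization lemma. -/
theorem exists_eq_comp_of_norm_apply_le {T : E →L[𝕜] G} {D : E →L[𝕜] F}
    (h : ∀ x, ‖T x‖ ≤ ‖D x‖) : ∃ U : F →L[𝕜] G, T = U ∘L D := by
  let K := (LinearMap.range (D : E →ₗ[𝕜] F)).topologicalClosure
  have : CompleteSpace K := (Submodule.isClosed_topologicalClosure _).completeSpace_coe
  let D' : E →ₗ[𝕜] K := (D : E →ₗ[𝕜] F).codRestrict K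
    fun x => Submodule.le_topologicalClosure _ ⟨x, rfl⟩
  have hdense : DenseRange D' := by
    rw [DenseRange, Subtype.dense_iff, ← Set.range_comp]
    exact subset_rfl
  refine ⟨((T : E →ₗ[𝕜] G).extendOfNorm D') ∘L K.orthogonalProjectionOnto, ?_⟩
  ext x
  have hx : K.orthogonalProjectionOnto (D x) = D' x :=
    Submodule.orthogonalProjectionOnto_mem_subspace_eq_self (D' x)
  rw [ContinuousLinearMap.comp_apply, ContinuousLinearMap.comp_apply, hx,
    LinearMap.extendOfNorm_eq hdense ⟨1, fun x => (h x).trans (one_mul _).ge⟩]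
  rfl

end Factorization

section CStarAlgebra

variable {A : Type*} [CStarAlgebra A] [PartialOrder A] [StarOrderedRing A]

theorem norm_cfcAbs_mul (a b : A) : ‖CFC.abs a * b‖ = ‖a * b‖ := by
  have h : star (CFC.abs a * b) * (CFC.abs a * b) = star (a * b) * (a * b) := by
    rw [star_mul, star_mul, (CFC.abs_nonneg a).isSelfAdjoint.star_eq, mul_assoc,
      ← mul_assoc (CFC.abs a), CFC.abs_mul_abs, mul_assoc, mul_assoc]
  rw [← sq_eq_sq₀ (norm_nonneg _) (norm_nonneg _), sq, sq, ← CStarRing.norm_star_mul_self, h,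
    CStarRing.norm_star_mul_self]

theorem sq_norm_sqrt_cfcAbs_mul_le (a b : A) :
    ‖CFC.sqrt (CFC.abs a) * b‖ ^ 2 ≤ ‖b‖ * ‖a * b‖ := by
  have h : star (CFC.sqrt (CFC.abs a) * b) * (CFC.sqrt (CFC.abs a) * b)
      = star b * (CFC.abs a * b) := by
    rw [star_mul, (CFC.sqrt_nonneg (CFC.abs a)).isSelfAdjoint.star_eq, mul_assoc,
      ← mul_assoc (CFC.sqrt _), CFC.sqrt_mul_sqrt_self _ (CFC.abs_nonneg a)]
  rw [sq, ← CStarRing.norm_star_mul_self, h, ← norm_cfcAbs_mul a, ← norm_star b]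
  exact norm_mul_le _ _

/-- With `p = (a + ε)^{-1/2}` one has `1 - p a p = ε (a + ε)⁻¹`. -/
theorem exists_isSelfAdjoint_mul_and_norm_le {a : A} (ha : 0 ≤ a) {ε : ℝ} (hε : 0 < ε) :
    ∃ p : A, IsSelfAdjoint (a * p) ∧ ‖1 - p * (a * p)‖ ≤ 1 ∧ ‖a * (1 - p * (a * p))‖ ≤ ε := by
  have hspec {t : ℝ} (ht : t ∈ spectrum ℝ a) : 0 ≤ t := spectrum_nonneg_of_nonneg ha ht
  let f : ℝ → ℝ := fun t => (√(t + ε))⁻¹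
  have hf : ContinuousOn f (spectrum ℝ a) := ContinuousOn.inv₀ (by fun_prop) fun t ht => by
    have := hspec ht
    positivity
  have hf_sq {t : ℝ} (ht : t ∈ spectrum ℝ a) : 1 - f t * (t * f t) = ε / (t + ε) := by
    have := hspec ht
    have h : f t * f t = (t + ε)⁻¹ := by rw [← mul_inv, Real.mul_self_sqrt (by positivity)]
    rw [mul_left_comm, h]
    field_simp
    ring
  have hap : a * cfc f a = cfc (fun t => t * f t) a := by
    rw [cfc_mul (fun t => t) f a, cfc_id' ℝ a]
  have hk : 1 - cfc f a * (a * cfc f a) = cfc (fun t => 1 - f t * (t * f t)) a := by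
    rw [cfc_sub (fun _ => 1) _ a, cfc_const_one ℝ a, cfc_mul f _ a, hap]
  refine ⟨cfc f a, hap ▸ cfc_predicate _ a, ?_, ?_⟩
  · rw [hk]
    refine norm_cfc_le zero_le_one fun t ht => ?_
    have := hspec ht
    rw [hf_sq ht, Real.norm_of_nonneg (by positivity), div_le_one (by positivity)]
    linarith
  · have hak : a * (1 - cfc f a * (a * cfc f a)) = cfc (fun t => t * (1 - f t * (t * f t))) a := by
      rw [cfc_mul (fun t => t) _ a, cfc_id' ℝ a, hk]
    rw [hak]
    refine norm_cfc_le hε.le fun t ht => ?_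
    have := hspec ht
    rw [hf_sq ht, Real.norm_of_nonneg (by positivity), mul_div_assoc', div_le_iff₀ (by positivity)]
    nlinarith

end CStarAlgebra

section TraceClass

variable {E : Type*} [NormedAddCommGroup E] [InnerProductSpace ℂ E] [CompleteSpace E]

theorem norm_cfcAbs_apply (T : E →L[ℂ] E) (x : E) : ‖CFC.abs T x‖ = ‖T x‖ := by
  have h : (CFC.abs T).adjoint ∘L CFC.abs T = T.adjoint ∘L T := by
    have h := CFC.abs_mul_abs T
    nth_rw 1 [← (CFC.abs_nonneg T).isSelfAdjoint.star_eq] at h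
    exact h
  rw [← sq_eq_sq₀ (norm_nonneg _) (norm_nonneg _),
    ContinuousLinearMap.apply_norm_sq_eq_inner_adjoint_right, h,
    ← ContinuousLinearMap.apply_norm_sq_eq_inner_adjoint_right]

namespace IsTraceClass

variable {T : E →L[ℂ] E} {ι : Type*}

theorem isHilbertSchmidt_sqrt (hT : IsTraceClass T) :
    IsHilbertSchmidt (CFC.sqrt (CFC.abs T)) := by
  refine hT.congr fun i => ?_
  have h : (CFC.sqrt (CFC.abs T)).adjoint ∘L CFC.sqrt (CFC.abs T) = CFC.abs T := by
    rw [← ContinuousLinearMap.star_eq_adjoint,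
      (CFC.sqrt_nonneg (CFC.abs T)).isSelfAdjoint.star_eq]
    exact CFC.sqrt_mul_sqrt_self _ (CFC.abs_nonneg T)
  rw [ContinuousLinearMap.apply_norm_sq_eq_inner_adjoint_right, h]
  rfl

theorem exists_eq_mul_sqrt (hT : IsTraceClass T) :
    ∃ V, IsHilbertSchmidt V ∧ T = V * CFC.sqrt (CFC.abs T) := by
  obtain ⟨U, hU⟩ := exists_eq_comp_of_norm_apply_le fun x => (norm_cfcAbs_apply T x).ge
  refine ⟨U * CFC.sqrt (CFC.abs T), hT.isHilbertSchmidt_sqrt.mul_left U, ?_⟩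
  rw [mul_assoc, CFC.sqrt_mul_sqrt_self _ (CFC.abs_nonneg T)]
  exact hU

theorem summable_inner (hT : IsTraceClass T) (b : HilbertBasis ι ℂ E) :
    Summable fun i => ⟪b i, T (b i)⟫_ℂ := by
  obtain ⟨V, hV, hVT⟩ := hT.exists_eq_mul_sqrt
  rw [hVT]
  exact hV.summable_inner_mul hT.isHilbertSchmidt_sqrt b

theorem opTrace_eq_tsum (hT : IsTraceClass T) (b : HilbertBasis ι ℂ E) :
    opTrace T = ∑' i, ⟪b i, T (b i)⟫_ℂ := by
  obtain ⟨V, hV, hVT⟩ := hT.exists_eq_mul_sqrt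
  have hW := hT.isHilbertSchmidt_sqrt
  rw [hVT, opTrace, hV.tsum_inner_mul_comm hW _ b, hW.tsum_inner_mul_comm hV b b]

theorem opTrace_mul_mul_comm (hT : IsTraceClass T) (B B' : E →L[ℂ] E) :
    opTrace (T * B * B') = opTrace (B' * T * B) := by
  obtain ⟨V, hV, hVT⟩ := hT.exists_eq_mul_sqrt
  have hW := hT.isHilbertSchmidt_sqrt
  have h₁ := hV.opTrace_mul_comm ((hW.mul_right B).mul_right B')
  have h₂ := (hV.mul_left B').opTrace_mul_comm (hW.mul_right B)
  rw [hVT]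
  simp only [mul_assoc] at h₁ h₂ ⊢
  rw [h₁, h₂]

theorem opTrace_sub_mul (hT : IsTraceClass T) (B : E →L[ℂ] E) :
    opTrace (T - T * B) = opTrace T - opTrace (T * B) := by
  obtain ⟨V, hV, hVT⟩ := hT.exists_eq_mul_sqrt
  have hTB := hV.summable_inner_mul (hT.isHilbertSchmidt_sqrt.mul_right B) (someHilbertBasis E)
  rw [← mul_assoc, ← hVT] at hTB
  simp only [opTrace, ← (hT.summable_inner (someHilbertBasis E)).tsum_sub hTB, sub_apply,
    inner_sub_right]

theorem tendsto_opTrace_mul (hT : IsTraceClass T) {α : Type*} {l : Filter α}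
    {K : α → E →L[ℂ] E} {c : ℝ} (hK : ∀ j, ‖K j‖ ≤ c)
    (hTK : Tendsto (fun j => T * K j) l (nhds 0)) :
    Tendsto (fun j => opTrace (T * K j)) l (nhds 0) := by
  obtain ⟨V, hV, hVT⟩ := hT.exists_eq_mul_sqrt
  have hsq : Tendsto (fun j => ‖CFC.sqrt (CFC.abs T) * K j‖ ^ 2) l (nhds 0) := by
    refine squeeze_zero (fun _ => sq_nonneg _) (fun j => ?_)
      (by simpa using hTK.norm.const_mul c)
    exact (sq_norm_sqrt_cfcAbs_mul_le T (K j)).trans (by gcongr; exact hK j)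
  have hSK : Tendsto (fun j => CFC.sqrt (CFC.abs T) * K j) l (nhds 0) :=
    tendsto_zero_iff_norm_tendsto_zero.2 (by simpa using hsq.sqrt)
  have h := hV.tendsto_opTrace_mul_mul hT.isHilbertSchmidt_sqrt hK hSK
  rwa [← hVT] at h

end IsTraceClass

open scoped ComplexOrder

theorem opTrace_nonneg {T : E →L[ℂ] E} (hT : T.IsPositive) : 0 ≤ opTrace T :=
  tsum_nonneg fun _ => hT.inner_nonneg_right _

theorem opTrace_mul_nonneg {A X : E →L[ℂ] E} (hA : A.IsPositive) (hX : X.IsPositive)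
    (hAX : IsTraceClass (A * X)) : 0 ≤ opTrace (A * X) := by
  choose P hP hK_le hXK using fun j : ℕ => exists_isSelfAdjoint_mul_and_norm_le
    ((ContinuousLinearMap.nonneg_iff_isPositive X).2 hX) (Nat.one_div_pos_of_nat (α := ℝ) (n := j))
  let K : ℕ → E →L[ℂ] E := fun j => 1 - P j * (X * P j)
  have hAXK : Tendsto (fun j => A * X * K j) atTop (nhds 0) := by
    refine squeeze_zero_norm (fun j => ?_)
      (by simpa only [mul_zero] using tendsto_one_div_add_atTop_nhds_zero_nat.const_mul ‖A‖)
    rw [mul_assoc]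
    exact (norm_mul_le _ _).trans (by gcongr; exact hXK j)
  have hpos (j : ℕ) : 0 ≤ opTrace (A * X) - opTrace (A * X * K j) := by
    have hcompress : A * X - A * X * K j = A * X * P j * (X * P j) := by
      simp only [K, mul_sub, mul_one, sub_sub_cancel, mul_assoc]
    rw [← hAX.opTrace_sub_mul, hcompress, hAX.opTrace_mul_mul_comm, mul_assoc, mul_assoc]
    refine opTrace_nonneg ?_
    have h := hA.conj_adjoint (X * P j)
    rwa [← ContinuousLinearMap.star_eq_adjoint, (hP j).star_eq] at h
  simpa using ge_of_tendsto' (tendsto_const_nhds.sub (hAX.tendsto_opTrace_mul hK_le hAXK)) hpos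

end TraceClass

/-! ### Tensor powers of operators -/

section TensorProduct

variable {𝕜 E F G : Type*} [RCLike 𝕜] [NormedAddCommGroup E] [InnerProductSpace 𝕜 E]
  [NormedAddCommGroup F] [InnerProductSpace 𝕜 F] [NormedAddCommGroup G] [NormedSpace 𝕜 G]

theorem ext_tmul_of_dense_span {S : Set E} {T : Set F}
    (hS : Dense (Submodule.span 𝕜 S : Set E)) (hT : Dense (Submodule.span 𝕜 T : Set F))
    {f g : E ⊗[𝕜] F →L[𝕜] G} (h : ∀ u ∈ S, ∀ v ∈ T, f (u ⊗ₜ[𝕜] v) = g (u ⊗ₜ[𝕜] v)) : f = g := by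
  have h_right (u : E) (hu : u ∈ S) :
      f ∘L TensorProduct.mkL 𝕜 E F u = g ∘L TensorProduct.mkL 𝕜 E F u :=
    ContinuousLinearMap.ext_on hT (h u hu)
  have h_left (v : F) :
      f ∘L (TensorProduct.mkL 𝕜 E F).flip v = g ∘L (TensorProduct.mkL 𝕜 E F).flip v :=
    ContinuousLinearMap.ext_on hS fun u hu => congr($(h_right u hu) v)
  exact ContinuousLinearMap.coe_injective
    (TensorProduct.ext' fun u v => congr($(h_left v) u))

end TensorProduct

namespace HilbertPow

variable {H : Type*} [NormedAddCommGroup H] [InnerProductSpace ℂ H] {n m : ℕ}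

theorem dense_span_range_tprod :
    Dense (Submodule.span ℂ (Set.range (tprod : (Fin n → H) → HilbertPow H n)) :
      Set (HilbertPow H n)) := by
  refine (denseRange_toComplL n).mono ?_
  rintro _ ⟨u, rfl⟩
  induction u using AlgPow.induction with
  | h1 c x =>
    rw [map_smul]
    exact Submodule.smul_mem _ c (Submodule.subset_span ⟨x, rfl⟩)
  | h2 u v hu hv =>
    rw [map_add]
    exact Submodule.add_mem _ hu hv

theorem ext_tprod {F : Type*} [NormedAddCommGroup F] [NormedSpace ℂ F]
    {f g : HilbertPow H n →L[ℂ] F} (h : ∀ x, f (tprod x) = g (tprod x)) : f = g :=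
  ContinuousLinearMap.ext_on dense_span_range_tprod (Set.forall_mem_range.2 h)

theorem opPow_mul (A B : H →L[ℂ] H) (n : ℕ) : opPow (A * B) n = opPow A n * opPow B n :=
  ext_tprod fun x => by
    rw [mul_apply_eq_comp, opPow_tprod, opPow_tprod, opPow_tprod]
    rfl

theorem opPow_adjoint [CompleteSpace H] (A : H →L[ℂ] H) (n : ℕ) :
    opPow A.adjoint n = (opPow A n).adjoint := by
  refine ext_tprod fun x => ext_inner_right ℂ fun u => ?_
  have h : innerSL ℂ (opPow A.adjoint n (tprod x)) =
      innerSL ℂ ((opPow A n).adjoint (tprod x)) := ext_tprod fun y => by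
    simp only [innerSL_apply_apply, ContinuousLinearMap.adjoint_inner_left, opPow_tprod,
      inner_tprod]
  exact congr($h u)

theorem opPow_isPositive [CompleteSpace H] {A : H →L[ℂ] H} (hA : A.IsPositive) (n : ℕ) :
    (opPow A n).IsPositive := by
  have hsqrt : (CFC.sqrt A).adjoint * CFC.sqrt A = A := by
    rw [← ContinuousLinearMap.star_eq_adjoint, (CFC.sqrt_nonneg A).isSelfAdjoint.star_eq]
    exact CFC.sqrt_mul_sqrt_self A ((ContinuousLinearMap.nonneg_iff_isPositive A).2 hA)
  rw [← hsqrt, opPow_mul, opPow_adjoint]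
  exact ContinuousLinearMap.isPositive_adjoint_comp_self _

theorem denseRange_concat : DenseRange (concat (H := H) n m) := by
  refine (denseRange_toComplL (n + m)).mono ?_
  rintro _ ⟨u, rfl⟩
  obtain ⟨s, rfl⟩ := (AlgPow.mulIsometry n m).surjective u
  exact ⟨incl n m s, concat_incl n m s⟩

theorem ext_comp_concat {F : Type*} [NormedAddCommGroup F] [NormedSpace ℂ F]
    {f g : HilbertPow H (n + m) →L[ℂ] F} (h : f ∘L concat n m = g ∘L concat n m) : f = g :=
  DFunLike.coe_injective <|
    denseRange_concat.equalizer f.continuous g.continuous congr(⇑$h)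

theorem inner_concat (s t : HilbertPow H n ⊗[ℂ] HilbertPow H m) :
    ⟪concat n m s, concat n m t⟫_ℂ = ⟪s, t⟫_ℂ := by
  refine (denseRange_incl n m).induction_on₂
    (p := fun s t => ⟪concat n m s, concat n m t⟫_ℂ = ⟪s, t⟫_ℂ)
    (isClosed_eq (by fun_prop)
      (continuous_inner (𝕜 := ℂ) (E := HilbertPow H n ⊗[ℂ] HilbertPow H m))) (fun s t => ?_) s t
  rw [LinearIsometry.coe_toContinuousLinearMap, concat_incl, concat_incl,
    UniformSpace.Completion.inner_coe, LinearIsometryEquiv.inner_map_map,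
    LinearIsometry.inner_map_map]

theorem opPow_concat (A : H →L[ℂ] H) (u : HilbertPow H n) (v : HilbertPow H m) :
    opPow A (n + m) (concat n m (u ⊗ₜ[ℂ] v)) =
      concat n m (opPow A n u ⊗ₜ[ℂ] opPow A m v) := by
  have h : opPow A (n + m) ∘L concat n m =
      concat n m ∘L TensorProduct.mapL (opPow A n) (opPow A m) := by
    refine ext_tmul_of_dense_span dense_span_range_tprod dense_span_range_tprod ?_
    rintro _ ⟨x, rfl⟩ _ ⟨y, rfl⟩
    have happend : (fun i => A (Fin.append x y i)) =
        Fin.append (fun i => A (x i)) (fun i => A (y i)) :=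
      funext fun i => by
        cases i using Fin.addCases <;> simp only [Fin.append_left, Fin.append_right]
    simp only [ContinuousLinearMap.comp_apply, TensorProduct.mapL_tmul, concat_tprod, opPow_tprod,
      happend]
  exact congr($h (u ⊗ₜ[ℂ] v))

theorem opPow_mul_opTensor (A : H →L[ℂ] H) (x₁ : HilbertPow H n →L[ℂ] HilbertPow H n)
    (x₂ : HilbertPow H m →L[ℂ] HilbertPow H m) :
    opPow A (n + m) * opTensor x₁ x₂ = opTensor (opPow A n * x₁) (opPow A m * x₂) :=
  ext_comp_concat <| ContinuousLinearMap.coe_injective <| TensorProduct.ext' fun u v => by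
    simp only [ContinuousLinearMap.coe_coe, ContinuousLinearMap.comp_apply, mul_apply_eq_comp,
      opTensor_concat, opPow_concat]

section Basis

variable {ι κ : Type*}

theorem orthonormal_concat {b : ι → HilbertPow H n} {c : κ → HilbertPow H m}
    (hb : Orthonormal ℂ b) (hc : Orthonormal ℂ c) :
    Orthonormal ℂ fun p : ι × κ => concat n m (b p.1 ⊗ₜ[ℂ] c p.2) := by
  classical
  rw [orthonormal_iff_ite] at hb hc ⊢
  intro p q
  rw [inner_concat, TensorProduct.inner_tmul, hb, hc]
  simp only [Prod.ext_iff, ite_and, ite_mul, one_mul, zero_mul]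

/-- The product `(bᵢ ⊗ cⱼ)` of two Hilbert bases. -/
noncomputable def concatBasis (b : HilbertBasis ι ℂ (HilbertPow H n))
    (c : HilbertBasis κ ℂ (HilbertPow H m)) : HilbertBasis (ι × κ) ℂ (HilbertPow H (n + m)) :=
  .mkOfOrthogonalEqBot (orthonormal_concat b.orthonormal c.orthonormal) <| by
    rw [Submodule.eq_bot_iff]
    intro u hu
    have h : innerSL ℂ u = 0 := by
      refine ext_comp_concat (ext_tmul_of_dense_span
        (Submodule.dense_iff_topologicalClosure_eq_top.2 b.dense_span)
        (Submodule.dense_iff_topologicalClosure_eq_top.2 c.dense_span) ?_)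
      rintro _ ⟨i, rfl⟩ _ ⟨j, rfl⟩
      exact (Submodule.mem_orthogonal' _ u).1 hu _ (Submodule.subset_span ⟨(i, j), rfl⟩)
    exact inner_self_eq_zero.1 congr($h u)

theorem concatBasis_apply (b : HilbertBasis ι ℂ (HilbertPow H n))
    (c : HilbertBasis κ ℂ (HilbertPow H m)) (p : ι × κ) :
    concatBasis b c p = concat n m (b p.1 ⊗ₜ[ℂ] c p.2) := by
  rw [concatBasis, HilbertBasis.coe_mkOfOrthogonalEqBot]

end Basis

theorem opTrace_opTensor {x₁ : HilbertPow H n →L[ℂ] HilbertPow H n}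
    {x₂ : HilbertPow H m →L[ℂ] HilbertPow H m} (h₁ : IsTraceClass x₁) (h₂ : IsTraceClass x₂)
    (h : IsTraceClass (opTensor x₁ x₂)) :
    opTrace (opTensor x₁ x₂) = opTrace x₁ * opTrace x₂ := by
  rw [h.opTrace_eq_tsum (concatBasis (someHilbertBasis _) (someHilbertBasis _)), opTrace, opTrace,
    tsum_mul_tsum_of_summable_norm (h₁.summable_inner _).norm (h₂.summable_inner _).norm]
  refine tsum_congr fun p => ?_
  rw [concatBasis_apply, opTensor_concat, inner_concat, TensorProduct.inner_tmul]

theorem trMul_opPow_opTensor [CompleteSpace H] {B : H →L[ℂ] H} (hB : B.IsPositive)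
    {x₁ : HilbertPow H n →L[ℂ] HilbertPow H n} {x₂ : HilbertPow H m →L[ℂ] HilbertPow H m}
    (hx₁ : x₁.IsPositive) (h₁ : IsTraceClass (opPow B n * x₁))
    (h₂ : IsTraceClass (opPow B m * x₂))
    (h : IsTraceClass (opPow B (n + m) * opTensor x₁ x₂)) :
    trMul (opPow B (n + m)) (opTensor x₁ x₂) = trMul (opPow B n) x₁ * trMul (opPow B m) x₂ := by
  obtain ⟨hre, him⟩ := Complex.nonneg_iff.1 (opTrace_mul_nonneg (opPow_isPositive hB n) hx₁ h₁)
  rw [opPow_mul_opTensor] at h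
  rw [trMul, opPow_mul_opTensor, opTrace_opTensor h₁ h₂ h, Complex.mul_re, ← him, zero_mul,
    sub_zero, ENNReal.ofReal_mul hre]
  rfl

end HilbertPow

/-! ### Integrals of logarithms -/

section LogIntegral

theorem max_log_ofReal_neg (t : ℝ) (k : ℕ) :
    max (ENNReal.log (ENNReal.ofReal t)) (-(k : EReal)) =
      ((Real.log (max t (Real.exp (-k))) : ℝ) : EReal) := by
  rw [← ENNReal.log_ofReal_of_pos (lt_max_of_lt_right (Real.exp_pos _)), ENNReal.ofReal_max,
    ENNReal.log_monotone.map_max, ENNReal.log_ofReal_of_pos (Real.exp_pos _), Real.log_exp,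
    EReal.coe_neg]
  rfl

theorem log_le_log_add_div_sub_one {a : ℝ≥0∞} (ha : a ≠ ⊤) {r : ℝ} (hr : 0 < r) :
    ENNReal.log a ≤ ((Real.log r + (a.toReal / r - 1) : ℝ) : EReal) := by
  rcases eq_or_ne a 0 with rfl | h0
  · simp
  · have ha_pos : 0 < a.toReal := ENNReal.toReal_pos h0 ha
    rw [← ENNReal.ofReal_toReal ha, ENNReal.log_ofReal_of_pos ha_pos,
      ENNReal.toReal_ofReal ha_pos.le, EReal.coe_le_coe_iff, ← sub_le_iff_le_add',
      ← Real.log_div ha_pos.ne' hr.ne']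
    exact Real.log_le_sub_one_of_pos (div_pos ha_pos hr)

theorem toENNReal_log_le (a : ℝ≥0∞) : (ENNReal.log a).toENNReal ≤ a := by
  rcases eq_or_ne a ⊤ with rfl | ha
  · exact le_top
  · have hle : ENNReal.log a ≤ (a.toReal : EReal) :=
      (log_le_log_add_div_sub_one ha one_pos).trans (EReal.coe_le_coe_iff.2 (by simp))
    simpa only [EReal.real_coe_toENNReal, ENNReal.ofReal_toReal ha] using
      EReal.toENNReal_le_toENNReal hle

variable {Y : Type*} [MeasurableSpace Y] {μ : Measure Y}

theorem erealIntegral_mono_ae {φ ψ : Y → EReal} (h : φ ≤ᵐ[μ] ψ) :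
    erealIntegral μ φ ≤ erealIntegral μ ψ :=
  EReal.sub_le_sub
    (EReal.coe_ennreal_le_coe_ennreal_iff.2
      (lintegral_mono_ae (h.mono fun _ hy => EReal.toENNReal_le_toENNReal hy)))
    (EReal.coe_ennreal_le_coe_ennreal_iff.2
      (lintegral_mono_ae (h.mono fun _ hy =>
        EReal.toENNReal_le_toENNReal (EReal.neg_le_neg_iff.2 hy))))

theorem erealIntegral_coe {g : Y → ℝ} (hg : Integrable g μ) :
    erealIntegral μ (fun y => (g y : EReal)) = ((∫ y, g y ∂μ : ℝ) : EReal) := by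
  have hneg : ∫⁻ y, ENNReal.ofReal (-g y) ∂μ ≠ ⊤ := hg.neg.lintegral_lt_top.ne
  simp only [erealIntegral, ← EReal.coe_neg, EReal.real_coe_toENNReal]
  rw [integral_eq_lintegral_pos_part_sub_lintegral_neg_part hg, EReal.coe_sub,
    EReal.coe_ennreal_toReal hg.lintegral_lt_top.ne, EReal.coe_ennreal_toReal hneg]

theorem tendsto_erealIntegral_max_neg_natCast {φ : Y → EReal} (hφ : Measurable φ)
    (hpos : ∫⁻ y, (φ y).toENNReal ∂μ ≠ ⊤) :
    Tendsto (fun k : ℕ => erealIntegral μ fun y => max (φ y) (-(k : EReal))) atTop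
      (nhds (erealIntegral μ φ)) := by
  have hmono : Monotone EReal.toENNReal := fun _ _ => EReal.toENNReal_le_toENNReal
  have hpos_part (y : Y) (k : ℕ) : (max (φ y) (-(k : EReal))).toENNReal = (φ y).toENNReal := by
    rw [hmono.map_max, EReal.toENNReal_of_nonpos (EReal.neg_le_zero.2 k.cast_nonneg'),
      max_eq_left zero_le]
  have hneg_part (y : Y) (k : ℕ) :
      (-max (φ y) (-(k : EReal))).toENNReal = min (-φ y).toENNReal k := by
    rw [EReal.neg_strictAnti.antitone.map_max, neg_neg, hmono.map_min]
    exact congrArg _ (EReal.toENNReal_coe (x := k))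
  have hlim : Tendsto (fun k : ℕ => ∫⁻ y, min (-φ y).toENNReal k ∂μ) atTop
      (nhds (∫⁻ y, (-φ y).toENNReal ∂μ)) := by
    refine lintegral_tendsto_of_tendsto_of_monotone
      (fun k => (by fun_prop : Measurable fun y => min (-φ y).toENNReal (k : ℝ≥0∞)).aemeasurable)
      (.of_forall fun y i j hij => min_le_min le_rfl (by exact_mod_cast hij))
      (.of_forall fun y => ?_)
    simpa only [le_top, inf_of_le_left] using
      (tendsto_const_nhds (x := (-φ y).toENNReal)).min ENNReal.tendsto_nat_nhds_top
  simp only [erealIntegral, hpos_part, hneg_part, sub_eq_add_neg]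
  have hadd := EReal.continuousAt_add (p := (↑(∫⁻ y, (φ y).toENNReal ∂μ),
    -↑(∫⁻ y, (-φ y).toENNReal ∂μ))) (.inl (mt EReal.coe_ennreal_eq_top_iff.1 hpos))
    (.inl (EReal.coe_ennreal_ne_bot _))
  exact hadd.tendsto.comp
    (tendsto_const_nhds.prodMk_nhds
      ((continuous_neg.comp continuous_coe_ennreal_ereal).tendsto _ |>.comp hlim))

theorem exp_erealIntegral_log_le_lintegral [IsProbabilityMeasure μ] {f : Y → ℝ≥0∞}
    (hf : AEMeasurable f μ) :
    EReal.exp (erealIntegral μ fun y => ENNReal.log (f y)) ≤ ∫⁻ y, f y ∂μ := by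
  refine le_of_forall_gt_imp_ge_of_dense fun c hc => ?_
  induction c with
  | top => exact le_top
  | coe r =>
    have hfin : ∫⁻ y, f y ∂μ ≠ ⊤ := (hc.trans ENNReal.coe_lt_top).ne
    have hf_lt_top : ∀ᵐ y ∂μ, f y < ⊤ := ae_lt_top' hf hfin
    have hr : (0 : ℝ) < r := by exact_mod_cast zero_le.trans_lt hc
    have hf_int : Integrable (fun y => (f y).toReal) μ :=
      integrable_toReal_of_lintegral_ne_top hf hfin
    have hmean : (∫⁻ y, f y ∂μ).toReal / r ≤ 1 :=
      (div_le_one hr).2 (ENNReal.toReal_le_coe_of_le_coe hc.le)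
    have htangent : ∫ y, (Real.log r + ((f y).toReal / r - 1)) ∂μ ≤ Real.log r := by
      rw [integral_add (by fun_prop) (by fun_prop), integral_sub (by fun_prop) (by fun_prop),
        integral_div, integral_toReal hf hf_lt_top]
      simp only [integral_const, probReal_univ, one_smul]
      linarith
    calc EReal.exp (erealIntegral μ fun y => ENNReal.log (f y))
        ≤ EReal.exp (Real.log r) := by
          refine EReal.exp_monotone ((erealIntegral_mono_ae
            (hf_lt_top.mono fun y hy => log_le_log_add_div_sub_one hy.ne hr)).trans ?_)
          rw [erealIntegral_coe (by fun_prop)]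
          exact EReal.coe_le_coe_iff.2 htangent
      _ = r := by rw [EReal.exp_coe, Real.exp_log hr, ENNReal.ofReal_coe_nnreal]

end LogIntegral

/-! ### A minimax principle for continuous functions -/

section Minimax

theorem convex_of_isClosed_of_midpoint_mem {V : Type*} [AddCommGroup V] [Module ℝ V]
    [TopologicalSpace V] [IsTopologicalAddGroup V] [ContinuousSMul ℝ V] {s : Set V}
    (hs : IsClosed s) (hmid : ∀ x ∈ s, ∀ y ∈ s, midpoint ℝ x y ∈ s) : Convex ℝ s := by
  refine convex_iff_segment_subset.2 fun x hx y hy => ?_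
  rw [segment_eq_image_lineMap]
  rintro _ ⟨t, ht, rfl⟩
  let T : Set ℝ := AffineMap.lineMap x y ⁻¹' s
  have hT : IsClosed T := hs.preimage AffineMap.lineMap_continuous
  have hT_mid (a : ℝ) (ha : a ∈ T) (b : ℝ) (hb : b ∈ T) : midpoint ℝ a b ∈ T := by
    simpa only [T, Set.mem_preimage, AffineMap.map_midpoint] using hmid _ ha _ hb
  obtain ⟨a, ⟨haT, ha⟩, ha_max⟩ := (isCompact_Icc.inter_left hT).exists_isGreatest
    ⟨0, by simpa [T] using hx, Set.left_mem_Icc.2 ht.1⟩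
  obtain ⟨b, ⟨hbT, hb⟩, hb_min⟩ := (isCompact_Icc.inter_left hT).exists_isLeast
    ⟨1, by simpa [T] using hy, Set.right_mem_Icc.2 ht.2⟩
  have hmid_mem : 2⁻¹ * (a + b) ∈ T := by
    simpa only [midpoint_eq_smul_add, invOf_eq_inv, smul_eq_mul] using hT_mid a haT b hbT
  suffices a = b by
    have : t = a := le_antisymm (this ▸ hb.1) ha.2
    exact this ▸ haT
  rcases le_total (2⁻¹ * (a + b)) t with hle | hle
  · have := ha_max ⟨hmid_mem, by linarith [ha.1, ha.2, hb.1], hle⟩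
    linarith [ha.2, hb.1]
  · have := hb_min ⟨hmid_mem, hle, by linarith [hb.2, ha.2, hb.1]⟩
    linarith [ha.2, hb.1]

variable {Y : Type*} [TopologicalSpace Y]

theorem convex_setOf_forall_neg : Convex ℝ {g : C(Y, ℝ) | ∀ y, g y < 0} :=
  fun _ hg _ hh _ _ ha hb hab y => convex_Iio (0 : ℝ) (hg y) (hh y) ha hb hab

theorem nonneg_of_forall_neg_lt (L : C(Y, ℝ) →ₗ[ℝ] ℝ) {u : ℝ}
    (hL : ∀ g : C(Y, ℝ), (∀ y, g y < 0) → L g < u) {g : C(Y, ℝ)} (hg : 0 ≤ g) : 0 ≤ L g := by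
  have hscale (t : ℝ) (ht : 0 ≤ t) : -(t * L g + L 1) < u := by
    have hneg (y : Y) : (-(t • g + 1)) y < 0 := by
      have : 0 ≤ t * g y := mul_nonneg ht (hg y)
      simp only [ContinuousMap.neg_apply, ContinuousMap.add_apply, ContinuousMap.smul_apply,
        ContinuousMap.one_apply, smul_eq_mul]
      linarith
    simpa only [map_neg, map_add, map_smul, smul_eq_mul] using hL _ hneg
  by_contra! hlt
  obtain ⟨k, hk⟩ := exists_nat_gt ((u + L 1) / -L g)
  rw [div_lt_iff₀ (neg_pos.2 hlt)] at hk
  linarith [hscale k k.cast_nonneg]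

variable [CompactSpace Y]

theorem isOpen_setOf_forall_neg : IsOpen {g : C(Y, ℝ) | ∀ y, g y < 0} := by
  simpa only [Set.MapsTo, Set.mem_univ, Set.mem_Iio, true_imp_iff] using
    ContinuousMap.isOpen_setOfPred_mapsTo (X := Y) isCompact_univ (isOpen_Iio (a := (0 : ℝ)))

/-- Separate `S` from the open cone of negative functions. -/
theorem exists_continuousLinearMap_nonneg {S : Set C(Y, ℝ)} (hne : S.Nonempty)
    (hmid : ∀ g ∈ S, ∀ h ∈ S, midpoint ℝ g h ∈ S) (hS : ∀ g ∈ S, ∃ y, 0 ≤ g y) :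
    ∃ L : C(Y, ℝ) →L[ℝ] ℝ, (∀ g, 0 ≤ g → 0 ≤ L g) ∧ L 1 = 1 ∧ ∀ g ∈ S, 0 ≤ L g := by
  have hmid_continuous : Continuous fun p : C(Y, ℝ) × C(Y, ℝ) => midpoint ℝ p.1 p.2 := by
    simp only [midpoint_eq_smul_add]
    fun_prop
  have hmid_closure (g : C(Y, ℝ)) (hg : g ∈ closure S) (h : C(Y, ℝ)) (hh : h ∈ closure S) :
      midpoint ℝ g h ∈ closure S :=
    map_mem_closure₂ hmid_continuous hg hh hmid
  have hdisj : Disjoint {g : C(Y, ℝ) | ∀ y, g y < 0} (closure S) := by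
    refine Disjoint.closure_right (Set.disjoint_left.2 fun g hg hgS => ?_) isOpen_setOf_forall_neg
    obtain ⟨y, hy⟩ := hS g hgS
    exact (hg y).not_ge hy
  obtain ⟨L, u, hL_lt, hL_ge⟩ := geometric_hahn_banach_open convex_setOf_forall_neg
    isOpen_setOf_forall_neg (convex_of_isClosed_of_midpoint_mem isClosed_closure hmid_closure) hdisj
  have hL_one : 0 < L 1 := by
    obtain ⟨g, hg⟩ := hne
    have := (hL_lt (g - (‖g‖ + 1) • 1) fun y => by
      have := (le_abs_self _).trans (g.norm_coe_le_norm y)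
      simp only [ContinuousMap.sub_apply, ContinuousMap.smul_apply, ContinuousMap.one_apply,
        smul_eq_mul]
      linarith).trans_le (hL_ge g (subset_closure hg))
    rw [map_sub, map_smul, smul_eq_mul, sub_lt_self_iff] at this
    exact pos_of_mul_pos_right this (by positivity)
  have hu : 0 ≤ u := by
    by_contra! hlt
    have := hL_lt ((u / L 1) • 1) fun y => by simpa using div_neg_of_neg_of_pos hlt hL_one
    rw [map_smul, smul_eq_mul, div_mul_cancel₀ _ hL_one.ne'] at this
    exact this.false
  refine ⟨(L 1)⁻¹ • L, fun g hg => ?_, inv_mul_cancel₀ hL_one.ne', fun g hg => ?_⟩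
  · exact mul_nonneg (inv_nonneg.2 hL_one.le)
      (nonneg_of_forall_neg_lt (L : C(Y, ℝ) →ₗ[ℝ] ℝ) hL_lt hg)
  · exact mul_nonneg (inv_nonneg.2 hL_one.le) (hu.trans (hL_ge g (subset_closure hg)))

variable [T2Space Y] [MeasurableSpace Y] [BorelSpace Y]

theorem exists_isProbabilityMeasure_integral_eq (L : C(Y, ℝ) →ₗ[ℝ] ℝ)
    (hL : ∀ g, 0 ≤ g → 0 ≤ L g) (hL_one : L 1 = 1) :
    ∃ ν : Measure Y, IsProbabilityMeasure ν ∧ ∀ g : C(Y, ℝ), ∫ y, g y ∂ν = L g := by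
  let Λ : CompactlySupportedContinuousMap Y ℝ →ₚ[ℝ] ℝ := PositiveLinearMap.mk₀
    { toFun := fun f => L f.toContinuousMap
      map_add' := fun f g => map_add L f.toContinuousMap g.toContinuousMap
      map_smul' := fun r f => map_smul L r f.toContinuousMap } fun f hf => hL _ hf
  have hint (g : C(Y, ℝ)) : ∫ y, g y ∂(RealRMK.rieszMeasure Λ) = L g :=
    RealRMK.integral_rieszMeasure Λ (CompactlySupportedContinuousMap.continuousMapEquiv g)
  refine ⟨RealRMK.rieszMeasure Λ, ⟨?_⟩, hint⟩
  simpa [Measure.real, ENNReal.toReal_eq_one_iff, hL_one] using hint 1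

theorem exists_isProbabilityMeasure_forall_integral_nonneg [Nonempty Y] {S : Set C(Y, ℝ)}
    (hmid : ∀ g ∈ S, ∀ h ∈ S, midpoint ℝ g h ∈ S) (hS : ∀ g ∈ S, ∃ y, 0 ≤ g y) :
    ∃ ν : Measure Y, IsProbabilityMeasure ν ∧ ∀ g ∈ S, 0 ≤ ∫ y, g y ∂ν := by
  rcases S.eq_empty_or_nonempty with rfl | hne
  · exact ⟨Measure.dirac (Classical.arbitrary Y), inferInstance, by simp⟩
  · obtain ⟨L, hL, hL_one, hLS⟩ := exists_continuousLinearMap_nonneg hne hmid hS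
    obtain ⟨ν, hν, hint⟩ := exists_isProbabilityMeasure_integral_eq (L : C(Y, ℝ) →ₗ[ℝ] ℝ) hL hL_one
    exact ⟨ν, hν, fun g hg => (hLS g hg).trans_eq (hint g).symm⟩

end Minimax

/-! ### Multiplicative families of functions -/

section MultiplicativeFamily

open scoped NNReal

theorem pow_mem_of_ne_zero {M : Type*} [Monoid M] {P : Subsemigroup M} {p : M} (hp : p ∈ P)
    {n : ℕ} (hn : n ≠ 0) : p ^ n ∈ P := by
  obtain ⟨n, rfl⟩ := Nat.exists_eq_succ_of_ne_zero hn
  induction n with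
  | zero => rwa [pow_one]
  | succ n ih => exact pow_succ p (n + 1) ▸ P.mul_mem (ih n.succ_ne_zero) hp

variable {Y : Type*} [TopologicalSpace Y]

/-- The functions `g` with `N g ≥ log (f / c)` for some `N ≥ 1` and some pair `(f, c)` of the
multiplicative family `P` with `c > 0`. The multiplicity `N` is what makes this set closed under
midpoints, and the exponential form of the inequality allows zeros of `f`. -/
def logMajorants (P : Subsemigroup (C(Y, ℝ≥0) × ℝ≥0)) : Set C(Y, ℝ) :=
  {g | ∃ p ∈ P, 0 < p.2 ∧ ∃ N : ℕ, N ≠ 0 ∧ ∀ y, (p.1 y : ℝ) ≤ p.2 * Real.exp (N * g y)}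

variable {P : Subsemigroup (C(Y, ℝ≥0) × ℝ≥0)}

theorem midpoint_mem_logMajorants {g h : C(Y, ℝ)} (hg : g ∈ logMajorants P)
    (hh : h ∈ logMajorants P) : midpoint ℝ g h ∈ logMajorants P := by
  obtain ⟨p, hp, hp_pos, N, hN, hgN⟩ := hg
  obtain ⟨q, hq, hq_pos, M, hM, hhM⟩ := hh
  refine ⟨p ^ M * q ^ N, P.mul_mem (pow_mem_of_ne_zero hp hM) (pow_mem_of_ne_zero hq hN),
    mul_pos (pow_pos hp_pos M) (pow_pos hq_pos N), 2 * (N * M), by positivity, fun y => ?_⟩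
  have hexponent : (2 * (N * M) : ℕ) * midpoint ℝ g h y = M * (N * g y) + N * (M * h y) := by
    simp only [midpoint_eq_smul_add, ContinuousMap.smul_apply, ContinuousMap.add_apply,
      invOf_eq_inv, smul_eq_mul]
    push_cast
    ring
  calc ((p ^ M * q ^ N).1 y : ℝ)
      = (p.1 y : ℝ) ^ M * (q.1 y : ℝ) ^ N := by simp
    _ ≤ (p.2 * Real.exp (N * g y)) ^ M * (q.2 * Real.exp (M * h y)) ^ N := by
        gcongr
        exacts [hgN y, hhM y]
    _ = (p ^ M * q ^ N).2 * Real.exp ((2 * (N * M) : ℕ) * midpoint ℝ g h y) := by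
        rw [hexponent, mul_pow, mul_pow, mul_mul_mul_comm, ← Real.exp_nat_mul,
          ← Real.exp_nat_mul, ← Real.exp_add]
        rfl

theorem exists_nonneg_of_mem_logMajorants (hP : ∀ p ∈ P, ∃ y, p.2 ≤ p.1 y) {g : C(Y, ℝ)}
    (hg : g ∈ logMajorants P) : ∃ y, 0 ≤ g y := by
  obtain ⟨p, hp, hp_pos, N, hN, hgN⟩ := hg
  obtain ⟨y, hy⟩ := hP p hp
  have hle : (p.2 : ℝ) * 1 ≤ p.2 * Real.exp (N * g y) := by
    rw [mul_one]
    exact (NNReal.coe_le_coe.2 hy).trans (hgN y)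
  have hexp : 0 ≤ N * g y :=
    Real.one_le_exp_iff.1 (le_of_mul_le_mul_left hle (NNReal.coe_pos.2 hp_pos))
  exact ⟨y, nonneg_of_mul_nonneg_right hexp (by positivity)⟩

theorem continuous_log_max_exp (f : C(Y, ℝ≥0)) (k : ℕ) :
    Continuous fun y => Real.log (max (f y) (Real.exp (-k))) :=
  Continuous.log (by fun_prop) fun _ => (lt_max_of_lt_right (Real.exp_pos _)).ne'

theorem log_max_exp_sub_log_mem_logMajorants {p : C(Y, ℝ≥0) × ℝ≥0} (hp : p ∈ P)
    (hp_pos : 0 < p.2) (k : ℕ) :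
    (⟨_, continuous_log_max_exp p.1 k⟩ - ContinuousMap.const Y (Real.log p.2) : C(Y, ℝ)) ∈
      logMajorants P := by
  refine ⟨p, hp, hp_pos, 1, one_ne_zero, fun y => ?_⟩
  have hc : (0 : ℝ) < p.2 := hp_pos
  simp only [ContinuousMap.sub_apply, ContinuousMap.coe_mk, ContinuousMap.const_apply,
    Nat.cast_one, one_mul]
  rw [Real.exp_sub, Real.exp_log (lt_max_of_lt_right (Real.exp_pos _)), Real.exp_log hc,
    mul_div_cancel₀ _ hc.ne']
  exact le_max_left _ _

variable [CompactSpace Y] [MeasurableSpace Y] [BorelSpace Y]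

theorem integrable_log_max_exp {ν : Measure Y} [IsFiniteMeasure ν] (f : C(Y, ℝ≥0)) (k : ℕ) :
    Integrable (fun y => Real.log (max (f y) (Real.exp (-k)))) ν :=
  (continuous_log_max_exp f k).integrable_of_hasCompactSupport (.of_compactSpace _)

/-- Truncate the logarithm at `-k`, and let `k` tend to infinity. -/
theorem le_erealIntegral_log_of_forall_le_integral {ν : Measure Y} [IsFiniteMeasure ν]
    (f : C(Y, ℝ≥0)) {a : ℝ}
    (h : ∀ k : ℕ, a ≤ ∫ y, Real.log (max (f y) (Real.exp (-k))) ∂ν) :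
    (a : EReal) ≤ erealIntegral ν fun y => ENNReal.log (f y) := by
  have hlog : Measurable fun y => ENNReal.log (f y) :=
    ENNReal.measurable_log.comp f.continuous.measurable.coe_nnreal_ennreal
  have hf_fin : ∫⁻ y, f y ∂ν < ⊤ :=
    (BoundedContinuousFunction.mkOfCompact f).lintegral_lt_top_of_nnreal ν
  have htrunc (k : ℕ) : (erealIntegral ν fun y => max (ENNReal.log (f y)) (-(k : EReal))) =
      ((∫ y, Real.log (max (f y) (Real.exp (-k))) ∂ν : ℝ) : EReal) := by
    rw [← erealIntegral_coe (integrable_log_max_exp f k)]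
    simp only [← max_log_ofReal_neg, ENNReal.ofReal_coe_nnreal]
  have hpos : ∫⁻ y, (ENNReal.log (f y)).toENNReal ∂ν ≠ ⊤ :=
    ((lintegral_mono fun y => toENNReal_log_le (f y)).trans_lt hf_fin).ne
  exact ge_of_tendsto' (tendsto_erealIntegral_max_neg_natCast hlog hpos) fun k => by
    rw [htrunc]
    exact EReal.coe_le_coe_iff.2 (h k)

variable [T2Space Y] [Nonempty Y]

theorem exists_isProbabilityMeasure_forall_le_exp_erealIntegral_log
    (hP : ∀ p ∈ P, ∃ y, p.2 ≤ p.1 y) :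
    ∃ ν : Measure Y, IsProbabilityMeasure ν ∧
      ∀ p ∈ P, (p.2 : ℝ≥0∞) ≤ EReal.exp (erealIntegral ν fun y => ENNReal.log (p.1 y)) := by
  obtain ⟨ν, hν, hint⟩ := exists_isProbabilityMeasure_forall_integral_nonneg
    (fun _ hg _ hh => midpoint_mem_logMajorants hg hh)
    (fun _ => exists_nonneg_of_mem_logMajorants hP)
  refine ⟨ν, hν, fun p hp => ?_⟩
  rcases eq_zero_or_pos p.2 with hzero | hp_pos
  · simp [hzero]
  have hlog (k : ℕ) : Real.log p.2 ≤ ∫ y, Real.log (max (p.1 y) (Real.exp (-k))) ∂ν := by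
    have := hint _ (log_max_exp_sub_log_mem_logMajorants hp hp_pos k)
    simp only [ContinuousMap.sub_apply, ContinuousMap.coe_mk, ContinuousMap.const_apply] at this
    rw [integral_sub (integrable_log_max_exp p.1 k)
      (integrable_const _), integral_const, probReal_univ, one_smul] at this
    exact sub_nonneg.1 this
  calc (p.2 : ℝ≥0∞) = EReal.exp (Real.log p.2) := by
        rw [EReal.exp_coe, Real.exp_log (NNReal.coe_pos.2 hp_pos),
          ENNReal.ofReal_coe_nnreal]
    _ ≤ _ := EReal.exp_monotone (le_erealIntegral_log_of_forall_le_integral p.1 hlog)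

end MultiplicativeFamily

/-! ### Subexponential masses and tensor powers -/

section Subexponential

open scoped NNReal

theorem pow_div_le_of_pow_le_lintegral {Y : Type*} [MeasurableSpace Y] {μ : Measure Y}
    {f : Y → ℝ≥0∞} {r s : ℝ≥0} {k : ℕ} (hr : r ≠ 0) (hf : ∀ y, f y ≤ r)
    (h : (s : ℝ≥0∞) ^ k ≤ ∫⁻ y, f y ^ k ∂μ) : (((s / r) ^ k : ℝ≥0) : ℝ≥0∞) ≤ μ Set.univ := by
  rw [div_pow, ENNReal.coe_div (pow_ne_zero k hr), ENNReal.coe_pow, ENNReal.coe_pow]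
  refine ENNReal.div_le_of_le_mul' (h.trans ?_)
  rw [← lintegral_const]
  exact lintegral_mono fun y => pow_le_pow_left₀ zero_le (hf y) k

theorem limsup_inv_mul_log_measure_univ {Y : Type*} [MeasurableSpace Y] {μ : ℕ → Measure Y}
    (hμ : ∀ n, 1 ≤ n → IsProbabilityMeasure (μ n)) :
    limsup (fun n : ℕ => (((n : ℝ)⁻¹ : ℝ) : EReal) * ENNReal.log (μ n Set.univ)) atTop = 0 := by
  refine (tendsto_const_nhds.congr' ?_).limsup_eq
  filter_upwards [eventually_ge_atTop 1] with n hn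
  have := hμ n hn
  rw [measure_univ, ENNReal.log_one, mul_zero]

/-- If `s / r > 1`, its `k`-th powers would be a lower bound for the masses of `μ (d * k)`. -/
theorem le_iSup_of_limsup_log_measure_univ_le {Y : Type*} [MeasurableSpace Y] {μ : ℕ → Measure Y}
    (hμ : limsup (fun n : ℕ => (((n : ℝ)⁻¹ : ℝ) : EReal) * ENNReal.log (μ n Set.univ)) atTop ≤ 0)
    {f : Y → ℝ≥0∞} {c : ℝ≥0∞} {d : ℕ} (hd : d ≠ 0)
    (h : ∀ k, k ≠ 0 → c ^ k ≤ ∫⁻ y, f y ^ k ∂μ (d * k)) : c ≤ ⨆ y, f y := by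
  by_contra! hlt
  obtain ⟨r, hfr, hrc⟩ := ENNReal.lt_iff_exists_nnreal_btwn.1 hlt
  obtain ⟨s, hrs, hsc⟩ := ENNReal.lt_iff_exists_nnreal_btwn.1 hrc
  have hr : 0 < r := by exact_mod_cast zero_le.trans_lt hfr
  have hratio : 1 < (s / r : ℝ≥0) := (one_lt_div hr).2 (by exact_mod_cast hrs)
  have hrate : 0 < Real.log (s / r : ℝ≥0) / d := div_pos (Real.log_pos hratio) (by positivity)
  obtain ⟨n₀, hn₀⟩ := eventually_atTop.1
    (eventually_lt_of_limsup_lt (hμ.trans_lt (EReal.coe_pos.2 hrate)))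
  obtain ⟨k, hk, hk_pos⟩ : ∃ k, n₀ ≤ k ∧ 0 < k := ⟨n₀ + 1, n₀.le_succ, n₀.succ_pos⟩
  have hmass : (((s / r) ^ k : ℝ≥0) : ℝ≥0∞) ≤ μ (d * k) Set.univ :=
    pow_div_le_of_pow_le_lintegral hr.ne' (fun y => (le_iSup f y).trans hfr.le)
      ((pow_le_pow_left₀ zero_le hsc.le k).trans (h k hk_pos.ne'))
  refine (hn₀ (d * k) (hk.trans (Nat.le_mul_of_pos_left k (Nat.pos_of_ne_zero hd)))).not_ge ?_
  calc ((Real.log (s / r : ℝ≥0) / d : ℝ) : EReal)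
      = ((((d * k : ℕ) : ℝ)⁻¹ : ℝ) : EReal) * ENNReal.log ((s / r) ^ k : ℝ≥0) := by
        rw [← ENNReal.ofReal_coe_nnreal, ENNReal.log_ofReal_of_pos (by positivity), ← EReal.coe_mul,
          NNReal.coe_pow, Real.log_pow]
        congr 1
        push_cast
        field_simp
    _ ≤ _ := mul_le_mul_of_nonneg_left (ENNReal.log_monotone hmass)
        (EReal.coe_nonneg.2 (by positivity))

end Subexponential

/-! ### Families of test operators -/

section TestFamily

open scoped NNReal

variable {H : Type*} [NormedAddCommGroup H] [InnerProductSpace ℂ H] {Y : Type*}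
  {A : Y → H →L[ℂ] H} {B C : H →L[ℂ] H} {X : (n : ℕ) → Set (HilbertPow H n →L[ℂ] HilbertPow H n)}

/-- The sets `X n`, for `n ≥ 1`, consist of positive operators and are closed under tensor products,
as the family of test operators of the theorem. -/
structure IsTensorFamily (X : (n : ℕ) → Set (HilbertPow H n →L[ℂ] HilbertPow H n)) : Prop where
  isPositive : ∀ n, 1 ≤ n → ∀ x ∈ X n, x.IsPositive
  opTensor_mem : ∀ n m, 1 ≤ n → 1 ≤ m → ∀ x₁ ∈ X n, ∀ x₂ ∈ X m, opTensor x₁ x₂ ∈ X (n + m)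

/-- `B` is positive and `B^{⊗n} x` is trace-class for every test operator `x ∈ X n`, `n ≥ 1`, as
required of the operators `A_y` and `C` of the theorem. -/
structure IsTraceAdmissible [CompleteSpace H]
    (X : (n : ℕ) → Set (HilbertPow H n →L[ℂ] HilbertPow H n)) (B : H →L[ℂ] H) : Prop where
  isPositive : B.IsPositive
  isTraceClass : ∀ n, 1 ≤ n → ∀ x ∈ X n, IsTraceClass (opPow B n * x)

theorem GeometricBound.arithmeticBound [MeasurableSpace Y] {ν : Measure Y} [IsProbabilityMeasure ν]
    {n : ℕ} (hmeas : ∀ x ∈ X n, AEMeasurable (fun y => trMul (opPow (A y) n) x) ν)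
    (h : GeometricBound A C X n ν) : ArithmeticBound A C X n ν :=
  fun x hx => (h x hx).trans (exp_erealIntegral_log_le_lintegral (hmeas x hx))

variable [CompleteSpace H]

theorem IsTraceAdmissible.trMul_opTensor (hB : IsTraceAdmissible X B) (hX : IsTensorFamily X)
    {n m : ℕ} (hn : 1 ≤ n) (hm : 1 ≤ m) {x₁ : HilbertPow H n →L[ℂ] HilbertPow H n} (hx₁ : x₁ ∈ X n)
    {x₂ : HilbertPow H m →L[ℂ] HilbertPow H m} (hx₂ : x₂ ∈ X m) :
    trMul (opPow B (n + m)) (opTensor x₁ x₂) = trMul (opPow B n) x₁ * trMul (opPow B m) x₂ :=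
  trMul_opPow_opTensor hB.isPositive (hX.isPositive n hn x₁ hx₁) (hB.isTraceClass n hn x₁ hx₁)
    (hB.isTraceClass m hm x₂ hx₂)
    (hB.isTraceClass _ (le_add_right hn) _ (hX.opTensor_mem n m hn hm x₁ hx₁ x₂ hx₂))

theorem IsTensorFamily.exists_trMul_eq_pow (hX : IsTensorFamily X) {n : ℕ} (hn : 1 ≤ n)
    {x : HilbertPow H n →L[ℂ] HilbertPow H n} (hx : x ∈ X n) {k : ℕ} (hk : k ≠ 0) :
    ∃ z ∈ X (n * k), ∀ B, IsTraceAdmissible X B →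
      trMul (opPow B (n * k)) z = trMul (opPow B n) x ^ k := by
  obtain ⟨k, rfl⟩ := Nat.exists_eq_succ_of_ne_zero hk
  induction k with
  | zero =>
    rw [Nat.succ_eq_add_one, zero_add, mul_one]
    exact ⟨x, hx, fun B _ => (pow_one _).symm⟩
  | succ k ih =>
    obtain ⟨z, hz, hpow⟩ := ih k.succ_ne_zero
    have hnk : 1 ≤ n * k.succ := Nat.mul_pos hn k.succ_pos
    refine ⟨opTensor z x, hX.opTensor_mem _ n hnk hn z hz x hx, fun B hB => ?_⟩
    exact (hB.trMul_opTensor hX hnk hn hz hx).trans (by rw [hpow B hB, ← pow_succ])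

theorem IsTensorFamily.supBound_of_limsup_le (hX : IsTensorFamily X)
    (hA : ∀ y, IsTraceAdmissible X (A y)) (hC : IsTraceAdmissible X C) [MeasurableSpace Y]
    {μ : ℕ → Measure Y}
    (hμ : limsup (fun n : ℕ => (((n : ℝ)⁻¹ : ℝ) : EReal) * ENNReal.log (μ n Set.univ)) atTop ≤ 0)
    (h : ∀ n, 1 ≤ n → ArithmeticBound A C X n (μ n)) {n : ℕ} (hn : 1 ≤ n) : SupBound A C X n := by
  refine fun x hx => le_iSup_of_limsup_log_measure_univ_le hμ (Nat.one_le_iff_ne_zero.1 hn)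
    fun k hk => ?_
  obtain ⟨z, hz, hpow⟩ := hX.exists_trMul_eq_pow hn hx hk
  simpa only [hpow C hC, hpow _ (hA _)] using
    h (n * k) (Nat.mul_pos hn (Nat.pos_of_ne_zero hk)) z hz

variable [TopologicalSpace Y]

/-- The pairs of a continuous function `y ↦ Tr A_y^{⊗n} x` and a number `Tr C^{⊗n} x`, for a test
operator `x ∈ X n`, `n ≥ 1`. They form a multiplicative family. -/
def tracePairs (hX : IsTensorFamily X) (hA : ∀ y, IsTraceAdmissible X (A y))
    (hC : IsTraceAdmissible X C) : Subsemigroup (C(Y, ℝ≥0) × ℝ≥0) where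
  carrier := {p | ∃ n, 1 ≤ n ∧ ∃ x ∈ X n,
    (∀ y, (p.1 y : ℝ≥0∞) = trMul (opPow (A y) n) x) ∧ (p.2 : ℝ≥0∞) = trMul (opPow C n) x}
  mul_mem' := by
    rintro p q ⟨n, hn, x₁, hx₁, hpA, hpC⟩ ⟨m, hm, x₂, hx₂, hqA, hqC⟩
    refine ⟨n + m, le_add_right hn, opTensor x₁ x₂, hX.opTensor_mem n m hn hm x₁ hx₁ x₂ hx₂,
      fun y => ?_, ?_⟩
    · rw [(hA y).trMul_opTensor hX hn hm hx₁ hx₂, ← hpA, ← hqA, ← ENNReal.coe_mul]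
      rfl
    · rw [hC.trMul_opTensor hX hn hm hx₁ hx₂, ← hpC, ← hqC, ← ENNReal.coe_mul]
      rfl

variable [CompactSpace Y] [Nonempty Y]

theorem exists_le_of_mem_tracePairs {hX : IsTensorFamily X} {hA : ∀ y, IsTraceAdmissible X (A y)}
    {hC : IsTraceAdmissible X C} (hsup : ∀ n, 1 ≤ n → SupBound A C X n) {p : C(Y, ℝ≥0) × ℝ≥0}
    (hp : p ∈ tracePairs hX hA hC) : ∃ y, p.2 ≤ p.1 y := by
  obtain ⟨n, hn, x, hx, hpA, hpC⟩ := hp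
  obtain ⟨y, -, hy⟩ := isCompact_univ.exists_isMaxOn Set.univ_nonempty p.1.continuous.continuousOn
  refine ⟨y, ENNReal.coe_le_coe.1 ?_⟩
  calc (p.2 : ℝ≥0∞) ≤ ⨆ y, (p.1 y : ℝ≥0∞) := by simpa only [hpA, hpC] using hsup n hn x hx
    _ ≤ p.1 y := iSup_le fun y' => ENNReal.coe_le_coe.2 (hy (Set.mem_univ y'))

theorem IsTensorFamily.exists_forall_geometricBound [T2Space Y] [MeasurableSpace Y] [BorelSpace Y]
    (hX : IsTensorFamily X) (hA : ∀ y, IsTraceAdmissible X (A y)) (hC : IsTraceAdmissible X C)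
    (hcont : ∀ n, 1 ≤ n → ∀ x ∈ X n, Continuous fun y => opTrace (opPow (A y) n * x))
    (hsup : ∀ n, 1 ≤ n → SupBound A C X n) :
    ∃ ν : Measure Y, IsProbabilityMeasure ν ∧ ∀ n, 1 ≤ n → GeometricBound A C X n ν := by
  obtain ⟨ν, hν, hle⟩ := exists_isProbabilityMeasure_forall_le_exp_erealIntegral_log
    fun _ => exists_le_of_mem_tracePairs (hX := hX) (hA := hA) (hC := hC) hsup
  refine ⟨ν, hν, fun n hn x hx => ?_⟩
  have hcont_re : Continuous fun y => (opTrace (opPow (A y) n * x)).re :=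
    Complex.continuous_re.comp (hcont n hn x hx)
  exact hle (⟨_, continuous_real_toNNReal.comp hcont_re⟩,
    (opTrace (opPow C n * x)).re.toNNReal) ⟨n, hn, x, hx, fun _ => rfl, rfl⟩

end TestFamily

theorem mainTheorem9_general
    {Y : Type*} [TopologicalSpace Y] [CompactSpace Y] [T2Space Y] [Nonempty Y]
    [MeasurableSpace Y] [BorelSpace Y]
    {H : Type*} [NormedAddCommGroup H] [InnerProductSpace ℂ H] [CompleteSpace H]
    (A : Y → H →L[ℂ] H) (hA : ∀ y, (A y).IsPositive)
    (C : H →L[ℂ] H) (hC : C.IsPositive)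
    (X : (n : ℕ) → Set (HilbertPow H n →L[ℂ] HilbertPow H n))
    (hX : ∀ n, 1 ≤ n → ∀ x ∈ X n, x.IsPositive)
    (hXA : ∀ n, 1 ≤ n → ∀ x ∈ X n, ∀ y, IsTraceClass (opPow (A y) n * x))
    (hXC : ∀ n, 1 ≤ n → ∀ x ∈ X n, IsTraceClass (opPow C n * x))
    (hXmul : ∀ n m, 1 ≤ n → 1 ≤ m → ∀ x₁ ∈ X n, ∀ x₂ ∈ X m, opTensor x₁ x₂ ∈ X (n + m))
    (hXcont : ∀ n, 1 ≤ n → ∀ x ∈ X n, Continuous fun y => opTrace (opPow (A y) n * x)) :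
    List.TFAE
      [∃ ν : Measure Y, IsProbabilityMeasure ν ∧ ∀ n, 1 ≤ n → GeometricBound A C X n ν,
        ∀ n, 1 ≤ n → ∃ ν : Measure Y, IsProbabilityMeasure ν ∧ GeometricBound A C X n ν,
        ∃ μ : Measure Y, IsProbabilityMeasure μ ∧ ∀ n, 1 ≤ n → ArithmeticBound A C X n μ,
        ∃ μ : ℕ → Measure Y,
          limsup (fun n : ℕ => (((n : ℝ)⁻¹ : ℝ) : EReal) * ENNReal.log (μ n Set.univ)) atTop ≤ 0 ∧
          ∀ n, 1 ≤ n → ArithmeticBound A C X n (μ n),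
        ∀ n, 1 ≤ n → SupBound A C X n] := by
  have hfamily : IsTensorFamily X := ⟨hX, hXmul⟩
  have hA_adm (y : Y) : IsTraceAdmissible X (A y) := ⟨hA y, fun n hn x hx => hXA n hn x hx y⟩
  have hC_adm : IsTraceAdmissible X C := ⟨hC, hXC⟩
  have hmeas (n : ℕ) (hn : 1 ≤ n) (ν : Measure Y) (x) (hx : x ∈ X n) :
      AEMeasurable (fun y => trMul (opPow (A y) n) x) ν :=
    (ENNReal.continuous_ofReal.comp
      (Complex.continuous_re.comp (hXcont n hn x hx))).measurable.aemeasurable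
  tfae_have 1 → 2 := fun ⟨ν, hν, h⟩ n hn => ⟨ν, hν, h n hn⟩
  tfae_have 1 → 3 := fun ⟨ν, hν, h⟩ => ⟨ν, hν, fun n hn => (h n hn).arithmeticBound (hmeas n hn ν)⟩
  tfae_have 2 → 4 := fun h => by
    choose! ν hν hgeom using h
    refine ⟨ν, (limsup_inv_mul_log_measure_univ hν).le, fun n hn => ?_⟩
    have := hν n hn
    exact (hgeom n hn).arithmeticBound (hmeas n hn (ν n))
  tfae_have 3 → 4 := fun ⟨μ, hμ, h⟩ =>
    ⟨fun _ => μ, (limsup_inv_mul_log_measure_univ fun _ _ => hμ).le, h⟩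
  tfae_have 4 → 5 := fun ⟨_, hμ, h⟩ _ hn => hfamily.supBound_of_limsup_le hA_adm hC_adm hμ h hn
  tfae_have 5 → 1 := hfamily.exists_forall_geometricBound hA_adm hC_adm hXcont
  tfae_finish

theorem mainTheorem9
    {Y : Type*} [TopologicalSpace Y] [CompactSpace Y] [T2Space Y] [Nonempty Y]
    [MeasurableSpace Y] [BorelSpace Y]
    {H : Type*} [NormedAddCommGroup H] [InnerProductSpace ℂ H] [CompleteSpace H]
    (A : Y → H →L[ℂ] H) (hA : ∀ y, (A y).IsPositive)
    (C : H →L[ℂ] H) (hC : C.IsPositive)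
    (X : (n : ℕ) → Set (HilbertPow H n →L[ℂ] HilbertPow H n))
    (hX : ∀ n, 1 ≤ n → ∀ x ∈ X n, x.IsPositive)
    (hXA : ∀ n, 1 ≤ n → ∀ x ∈ X n, ∀ y, IsTraceClass (opPow (A y) n * x))
    (hXC : ∀ n, 1 ≤ n → ∀ x ∈ X n, IsTraceClass (opPow C n * x))
    (hXmul : ∀ n m, 1 ≤ n → 1 ≤ m → ∀ x₁ ∈ X n, ∀ x₂ ∈ X m, opTensor x₁ x₂ ∈ X (n + m))
    (hXcont : ∀ n, 1 ≤ n → ∀ x ∈ X n, Continuous fun y => opTrace (opPow (A y) n * x)) :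
    List.TFAE
      [∃ ν : Measure Y, IsProbabilityMeasure ν ∧ ∀ n, 1 ≤ n → GeometricBound A C X n ν,
        ∀ n, 1 ≤ n → ∃ ν : Measure Y, IsProbabilityMeasure ν ∧ GeometricBound A C X n ν,
        ∃ μ : Measure Y, IsProbabilityMeasure μ ∧ ∀ n, 1 ≤ n → ArithmeticBound A C X n μ,
        ∃ μ : ℕ → Measure Y,
          limsup (fun n : ℕ => (((n : ℝ)⁻¹ : ℝ) : EReal) * ENNReal.log (μ n Set.univ)) atTop ≤ 0 ∧
          ∀ n, 1 ≤ n → ArithmeticBound A C X n (μ n)] ∧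
    ((∃ μ : ℕ → Measure Y,
        limsup (fun n : ℕ => (((n : ℝ)⁻¹ : ℝ) : EReal) * ENNReal.log (μ n Set.univ)) atTop ≤ 0 ∧
        ∀ n, 1 ≤ n → ArithmeticBound A C X n (μ n)) →
      ∀ n, 1 ≤ n → SupBound A C X n) := by
  have h := mainTheorem9_general A hA C hC X hX hXA hXC hXmul hXcont
  exact ⟨fun a ha b hb => h a (List.mem_append_left [_] ha) b (List.mem_append_left [_] hb),
    (h.out 3 4).1⟩
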